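/- **Setting.** Let $n\ge 1$, and let $\Omega\subset\mathbb R^n$ be a (nonempty, connected) domain with a finite conforming mesh $\mathcal M$ whose cells are nondegenerate simplices or parallelotopes (in particular triangles, rectangles, tetrahedra, cuboids): $\Omega$ is the interior of the union of the closed cells, and any two cells intersect in a common face, possibly empty. Let $\mathcal F$ be a finite forest of rooted trees with node set $\mathcal N$ and edge set $\mathcal E$; each tree has exactly one root, each root has exactly one neighbor, and the roots are split into Dirichlet roots $\mathcal N_D$ and Neumann roots $\mathcal N_N$, with $\mathcal N_D\neq\emptyset$. The terminal nodes $\mathcal N_T$ are the leaves that are not roots. Write $\mathcal N_i$ for the set of neighbors of $i$. The data are: a permeability $k^D:\Omega\to\mathbb R^{n\times n}$, integrable and symmetric positive definite a.e.; conductivities $k^N_e>0$, $e\in\mathcal E$; and for each $i\in\mathcal N_T$ a measurable set $B_i\subseteq\Omega$ and a measurable function $k_i^T\ge 0$ vanishing outside $B_i$ such that $k_i^S:=\sqrt{k_i^T}$ satisfies $k_i^S\le C_{k^S}$ on $\Omega$ and $\int_{B_i}k_i^S\,dx\ge c_{k^S}>0$. Let $L^2(\mathfrak B)=L^2(\Omega)\times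 l^2(\mathcal N\setminus\mathcal N_D)$ with inner product $(\mathfrak p,\mathfrak w)=\int_\Omega p^Dw^D\,dx+\sum_{i\in\mathcal N\setminus\mathcal N_D}p^N_iw^N_i$ and norm $\|\cdot\|_{L^2(\mathfrak B)}$, and let $$L_h^2(\mathfrak B)=P_0(\mathcal M)\times l^2(\mathcal N\setminus\mathcal N_D),\qquad H_{h,0}(\operatorname{div},\mathfrak B)=H_{h,0}(\operatorname{div},\mathcal M)\times\prod_{i\in\mathcal N_T}P_0(\mathcal M_i)\times l^2(\mathcal E),$$ where $H_{h,0}(\operatorname{div},\mathcal M)$ is the lowest-order Raviart–Thomas space on $\mathcal M$ with zero normal component on $\partial\Omega$ and $P_0(\mathcal M_i)$ consists of the restrictions to $B_i$ (a.e.) of the piecewise constant functions on $\mathcal M$. A network flux $q^N\in l^2(\mathcal E)$ has one unknown per edge, with $q^N_{j,i}=-q^N_{i,j}$. For $\mathfrak q=[\boldsymbol q^D,q^S,q^N]$ put $\mathfrak D\cdot\mathfrak q=[u^D,u^N]$ with $$u^D=\nabla\cdot\boldsymbol q^D-\sum_{i\in\mathcal N_T}k_i^Sq_i^S,\qquad u^N_i=\begin{cases}\int_{B_i}k_i^Sq_i^S\,dx-\sum_{j\in\mathcal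 N_i}q^N_{j,i}, & i\in\mathcal N_T,\\ -\sum_{j\in\mathcal N_i}q^N_{j,i}, & i\in\mathcal N\setminus(\mathcal N_D\cup\mathcal N_T),\end{cases}$$ and define the mass-lumped inner product $$(\mathfrak q,\mathfrak v)_{\mathfrak K^{-1},h}=\sum_{\tau\in\mathcal M}\sum_{f\subset\partial\tau}\omega_f(\boldsymbol q^D\cdot\boldsymbol n_f)(\boldsymbol v^D\cdot\boldsymbol n_f)+\sum_{i\in\mathcal N_T}\int_{B_i}q_i^Sv_i^S\,dx+\sum_{e(i,j)\in\mathcal E}(k^N_{e(i,j)})^{-1}q^N_{i,j}v^N_{i,j},$$ where, for a facet $f$ of the cell $\tau$ with outward unit normal $\boldsymbol n_f$, $\omega_f=\big(\boldsymbol n_f\cdot(k^D_\tau)^{-1}\boldsymbol n_f\big)\frac{d_f}{2|f|}$, $k^D_\tau$ is the average of $k^D$ on $\tau$, and $d_f$ is the distance between $f$ and the barycenter of $\tau$ (for scalar $k^D$ this is $(k^D_\tau)^{-1}\frac{d_f}{2|f|}$). The discrete gradient $\mathfrak D_h\mathfrak p_h\in H_{h,0}(\operatorname{div},\mathfrak B)$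 of $\mathfrak p_h\in L^2_h(\mathfrak B)$ is defined by $(\mathfrak D_h\mathfrak p_h,\mathfrak v_h)_{\mathfrak K^{-1},h}=-(\mathfrak p_h,\mathfrak D\cdot\mathfrak v_h)$ for all $\mathfrak v_h\in H_{h,0}(\operatorname{div},\mathfrak B)$. The mass-lumped mixed formulation with right-hand side $\mathfrak r\in L^2(\mathfrak B)$ is: find $\mathfrak q_h\in H_{h,0}(\operatorname{div},\mathfrak B)$, $\mathfrak p_h\in L_h^2(\mathfrak B)$ with $$(\mathfrak q_h,\mathfrak v_h)_{\mathfrak K^{-1},h}-(\mathfrak p_h,\mathfrak D\cdot\mathfrak v_h)=0,\qquad -(\mathfrak D\cdot\mathfrak q_h,\mathfrak w_h)=-(\mathfrak r,\mathfrak w_h)$$ for all $\mathfrak v_h\in H_{h,0}(\operatorname{div},\mathfrak B)$, $\mathfrak w_h\in L_h^2(\mathfrak B)$. The two-point flux approximation (TPFA) scheme is: find $\mathfrak p_h\in L^2_h(\mathfrak B)$ with $$(\mathfrak D_h\mathfrak p_h,\mathfrak D_h\mathfrak w_h)_{\mathfrak K^{-1},h}=(\mathfrak r,\mathfrak w_h)\qquad\text{for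 all }\mathfrak w_h\in L^2_h(\mathfrak B).$$ **Theorem.** The TPFA scheme is well-posed. That is: 1. every $\mathfrak p_h\in L_h^2(\mathfrak B)$ has exactly one discrete gradient $\mathfrak D_h\mathfrak p_h$; 2. there is a constant $C>0$, independent of $\mathfrak r$, such that for every $\mathfrak r\in L^2(\mathfrak B)$ the TPFA scheme has exactly one solution $\mathfrak p_h\in L_h^2(\mathfrak B)$, and it satisfies $\|\mathfrak p_h\|_{L^2(\mathfrak B)}+(\mathfrak D_h\mathfrak p_h,\mathfrak D_h\mathfrak p_h)_{\mathfrak K^{-1},h}^{1/2}\le C\,\|\mathfrak r\|_{L^2(\mathfrak B)}$; 3. the scheme is equivalent to the mass-lumped mixed formulation: for every $\mathfrak r\in L^2(\mathfrak B)$, a pair $(\mathfrak q_h,\mathfrak p_h)$ solves the mass-lumped mixed formulation if and only if $\mathfrak p_h$ solves the TPFA scheme and $\mathfrak q_h=-\mathfrak D_h\mathfrak p_h$. -/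

import Mathlib

open MeasureTheory

noncomputable section

namespace NetworkDarcy

open scoped Classical

/-- Euclidean space `ℝⁿ`. -/
abbrev Euc (n : ℕ) : Type := EuclideanSpace ℝ (Fin n)

/-! ### Mesh cells and the lowest-order Raviart-Thomas element -/

/-- A mesh cell in `ℝⁿ`: a nondegenerate simplex (triangle, tetrahedron, ...), or a nondegenerate
parallelotope (rectangle, parallelogram, cuboid, ...) with corner `b` and edge vectors `e`. -/
inductive Cell (n : ℕ) : Type
  | simplex (s : Affine.Simplex ℝ (Euc n) n) : Cell n
  | box (b : Euc n) (e : Module.Basis (Fin n) ℝ (Euc n)) : Cell n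

namespace Cell

variable {n : ℕ}

/-- The closed cell as a set. -/
def carrier : Cell n → Set (Euc n)
  | simplex s => s.closedInterior
  | box b e => {x | ∀ i, e.repr (x - b) i ∈ Set.Icc (0 : ℝ) 1}

/-- Index type of the facets (`(n-1)`-dimensional faces) of a cell: one for each vertex of a simplex
(the facet opposite to it), two for each direction of a parallelotope. -/
def Facet : Cell n → Type
  | simplex _ => Fin (n + 1)
  | box _ _ => Fin n × Bool

instance (c : Cell n) : Fintype c.Facet :=
  match c with
  | simplex _ => inferInstanceAs (Fintype (Fin (n + 1)))
  | box _ _ => inferInstanceAs (Fintype (Fin n × Bool))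

/-- The cell center (barycenter). -/
def center : Cell n → Euc n
  | simplex s => s.centroid
  | box b e => b + (2⁻¹ : ℝ) • ∑ i, e i

/-- The (closed) facets as sets. -/
def facet [NeZero n] : (c : Cell n) → c.Facet → Set (Euc n)
  | simplex s, i => (s.faceOpposite i).closedInterior
  | box b e, (i, t) => {x ∈ (box b e).carrier | e.repr (x - b) i = if t then 1 else 0}

/-- The barycenter of a facet. -/
def facetCenter [NeZero n] : (c : Cell n) → c.Facet → Euc n
  | simplex s, i => s.faceOppositeCentroid i
  | box b e, (i, t) =>
      (box b e).center + (if t then (2⁻¹ : ℝ) else -2⁻¹) • e i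

/-- The gradient of the `i`-th coordinate function of a basis of `ℝⁿ`: the vector `g` with
`⟪g, x⟫ = e.repr x i`. -/
def coordGrad (e : Module.Basis (Fin n) ℝ (Euc n)) (i : Fin n) : Euc n :=
  (InnerProductSpace.toDual ℝ (Euc n)).symm (LinearMap.toContinuousLinearMap (e.coord i))

/-- The outward unit normal of a cell on a facet. -/
def normal [NeZero n] : (c : Cell n) → c.Facet → Euc n
  | simplex s, i => (s.height i)⁻¹ • (s.altitudeFoot i - s.points i)
  | box _ e, (i, t) => (if t then (1 : ℝ) else -1) • (‖coordGrad e i‖⁻¹ • coordGrad e i)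

/-- The local lowest-order Raviart-Thomas space of a cell: fields `a + c x` (with `a ∈ ℝⁿ`, `c ∈ ℝ`)
on a simplex, and fields `∑ᵢ (aᵢ + cᵢ tᵢ) eᵢ` on a parallelotope, where `tᵢ` are the coordinates
of `x - b` in the basis `e` (for a cuboid with sides parallel to the axes: the `i`-th component is
an affine function of `xᵢ`). -/
def RT0 : Cell n → Submodule ℝ (Euc n → Euc n)
  | simplex _ =>
    { carrier := {q | ∃ (a : Euc n) (c : ℝ), ∀ x, q x = a + c • x}
      add_mem' := by
        rintro _ _ ⟨a, c, h⟩ ⟨a', c', h'⟩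
        refine ⟨a + a', c + c', fun x => ?_⟩
        rw [Pi.add_apply, h, h', add_smul]
        abel
      zero_mem' := ⟨0, 0, fun x => by simp⟩
      smul_mem' := by
        rintro r _ ⟨a, c, h⟩
        refine ⟨r • a, r * c, fun x => ?_⟩
        rw [Pi.smul_apply, h, smul_add, smul_smul] }
  | box b e =>
    { carrier := {q | ∃ a c : Fin n → ℝ, ∀ x, q x = ∑ i, (a i + c i * e.repr (x - b) i) • e i}
      add_mem' := by
        rintro _ _ ⟨a, c, h⟩ ⟨a', c', h'⟩
        refine ⟨a + a', c + c', fun x => ?_⟩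
        rw [Pi.add_apply, h, h', ← Finset.sum_add_distrib]
        refine Finset.sum_congr rfl fun i _ => ?_
        rw [← add_smul, Pi.add_apply, Pi.add_apply]
        ring_nf
      zero_mem' := ⟨0, 0, fun x => by simp⟩
      smul_mem' := by
        rintro r _ ⟨a, c, h⟩
        refine ⟨r • a, r • c, fun x => ?_⟩
        rw [Pi.smul_apply, h, Finset.smul_sum]
        refine Finset.sum_congr rfl fun i _ => ?_
        rw [smul_smul, Pi.smul_apply, Pi.smul_apply, smul_eq_mul, smul_eq_mul]
        ring_nf }

end Cell

/-- The divergence of a vector field on `ℝⁿ`. -/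
def divergence {n : ℕ} (q : Euc n → Euc n) (x : Euc n) : ℝ :=
  ∑ i, (fderiv ℝ q x (EuclideanSpace.single i 1)) i

/-! ### Meshes, `P₀` and `RT₀` -/

/-- A (conforming, finite) mesh of `Ω ⊆ ℝⁿ`, with cells indexed by `ι`: the cells are pairwise
different, `Ω` is the interior of their union, and the intersection of any two cells is a common
face of both, possibly empty. (For polytopes, the faces are the convex extreme subsets.) -/
structure Mesh {n : ℕ} (ι : Type*) (Ω : Set (Euc n)) where
  cell : ι → Cell n
  cell_injective : Function.Injective fun τ => (cell τ).carrier
  interior_union : interior (⋃ τ, (cell τ).carrier) = Ω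
  conforming : ∀ τ σ, IsExtreme ℝ (cell τ).carrier ((cell τ).carrier ∩ (cell σ).carrier)

namespace Mesh

variable {n : ℕ} {ι : Type*} {Ω : Set (Euc n)}

/-- The function on `Ω` that is given by the function `u τ` inside each cell `τ`. (Its values on the
null set of cell boundaries do not matter.) -/
def glue [Fintype ι] (M : Mesh ι Ω) (u : ι → Euc n → ℝ) (x : Euc n) : ℝ :=
  ∑ τ, (interior (M.cell τ).carrier).indicator (u τ) x

/-- The piecewise constant function with the value `p τ` on the cell `τ`: the elements of
`P₀(𝓜)` are represented by their values. -/
def pwConst [Fintype ι] (M : Mesh ι Ω) (p : ι → ℝ) : Euc n → ℝ :=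
  M.glue fun τ _ => p τ

/-- The space `H_h(div, 𝓜)`: fields that are in the local Raviart-Thomas space on each cell, with
continuous normal component across the facets that two cells share. A field is given by the family
of its restrictions to the cells. -/
def RT [NeZero n] (M : Mesh ι Ω) : Submodule ℝ (ι → Euc n → Euc n) where
  carrier := {q | (∀ τ, q τ ∈ (M.cell τ).RT0) ∧
    ∀ τ σ, τ ≠ σ → ∀ (f : (M.cell τ).Facet) (g : (M.cell σ).Facet),
      (M.cell τ).facet f = (M.cell σ).facet g → ∀ x ∈ (M.cell τ).facet f,
        inner ℝ (q τ x) ((M.cell τ).normal f) + inner ℝ (q σ x) ((M.cell σ).normal g) = 0}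
  add_mem' := by
    rintro q q' ⟨h1, h2⟩ ⟨h1', h2'⟩
    refine ⟨fun τ => add_mem (h1 τ) (h1' τ), fun τ σ hne f g hfg x hx => ?_⟩
    have := h2 τ σ hne f g hfg x hx
    have := h2' τ σ hne f g hfg x hx
    simp only [Pi.add_apply, inner_add_left]
    linarith
  zero_mem' := ⟨fun τ => zero_mem _, fun τ σ _ f g _ x _ => by simp⟩
  smul_mem' := by
    rintro r q ⟨h1, h2⟩
    refine ⟨fun τ => Submodule.smul_mem _ r (h1 τ), fun τ σ hne f g hfg x hx => ?_⟩
    have := h2 τ σ hne f g hfg x hx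
    simp only [Pi.smul_apply, real_inner_smul_left]
    rw [← mul_add, this, mul_zero]

/-- The space `H_{h,0}(div, 𝓜)`: the fields in `H_h(div, 𝓜)` with zero normal component on `∂Ω`. -/
def RTzero [NeZero n] (M : Mesh ι Ω) : Submodule ℝ (ι → Euc n → Euc n) where
  carrier := {q | q ∈ M.RT ∧ ∀ τ (f : (M.cell τ).Facet), (M.cell τ).facet f ⊆ frontier Ω →
    ∀ x ∈ (M.cell τ).facet f, inner ℝ (q τ x) ((M.cell τ).normal f) = 0}
  add_mem' := by
    rintro q q' ⟨h1, h2⟩ ⟨h1', h2'⟩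
    refine ⟨add_mem h1 h1', fun τ f hf x hx => ?_⟩
    simp [inner_add_left, h2 τ f hf x hx, h2' τ f hf x hx]
  zero_mem' := ⟨zero_mem _, fun τ f _ x _ => by simp⟩
  smul_mem' := by
    rintro r q ⟨h1, h2⟩
    refine ⟨Submodule.smul_mem _ r h1, fun τ f hf x hx => ?_⟩
    simp [real_inner_smul_left, h2 τ f hf x hx]

end Mesh

/-! ### The network -/

/-- A finite forest of rooted trees on the node set `V`, with roots split into Dirichlet and Neumann
roots: each tree (connected component) has exactly one root, and roots have exactly one
neighbor. -/
structure RootedForest (V : Type*) where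
  graph : SimpleGraph V
  acyclic : graph.IsAcyclic
  dirichlet : Set V
  neumann : Set V
  disjoint : Disjoint dirichlet neumann
  existsUnique_root : ∀ c : graph.ConnectedComponent,
    ∃! v, v ∈ dirichlet ∪ neumann ∧ graph.connectedComponentMk v = c
  root_degree : ∀ v ∈ dirichlet ∪ neumann, ∃! w, graph.Adj v w

namespace RootedForest

variable {V : Type*} (F : RootedForest V)

/-- Terminal nodes: the leaves other than the roots. (The remaining nodes, which are neither roots
nor terminal, are the interior nodes.) -/
def IsTerminal (v : V) : Prop :=
  v ∉ F.dirichlet ∪ F.neumann ∧ ∃! w, F.graph.Adj v w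

/-- The set of terminal nodes. -/
abbrev Terminal : Type _ := {v : V // F.IsTerminal v}

/-- The nodes other than the Dirichlet roots. -/
abbrev Free : Type _ := {v : V // v ∉ F.dirichlet}

/-- The network fluxes `l²(𝓔)`: `q i j` is the flow from `i` to `j` along an edge, and `q i j` and
`q j i = -q i j` are one unknown; there is no flow between nodes that are not adjacent. -/
def EdgeFlux : Submodule ℝ (V → V → ℝ) where
  carrier := {q | (∀ i j, q i j = -q j i) ∧ ∀ i j, ¬ F.graph.Adj i j → q i j = 0}
  add_mem' := by
    rintro q q' ⟨h1, h2⟩ ⟨h1', h2'⟩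
    refine ⟨fun i j => ?_, fun i j h => ?_⟩
    · simp only [Pi.add_apply]
      rw [h1 i j, h1' i j]
      ring
    · simp [h2 i j h, h2' i j h]
  zero_mem' := ⟨fun i j => by simp, fun i j _ => rfl⟩
  smul_mem' := by
    rintro r q ⟨h1, h2⟩
    refine ⟨fun i j => ?_, fun i j h => ?_⟩
    · simp only [Pi.smul_apply, smul_eq_mul]
      rw [h1 i j]
      ring
    · simp [h2 i j h]

end RootedForest

/-! ### Material parameters -/

/-- The material parameters: the permeability tensor `kD` (integrable, symmetric positive definite
almost everywhere), the conductivities `kN` of the edges (positive), and for each terminal node `i`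
the region `B i ⊆ Ω` and the transfer coefficient `kT i ≥ 0`, which vanishes outside `B i` and whose
square root is bounded from above and has an integral over `B i` that is bounded from below. The
transfer coefficient may vanish on parts of `B i`. -/
structure Parameters {n : ℕ} {V : Type*} (Ω : Set (Euc n)) (F : RootedForest V) where
  kD : Euc n → Matrix (Fin n) (Fin n) ℝ
  kD_integrable : ∀ i j, IntegrableOn (fun x => kD x i j) Ω
  kD_posDef : ∀ᵐ x ∂(volume.restrict Ω), (kD x).PosDef
  kN : Sym2 V → ℝ
  kN_pos : ∀ e ∈ F.graph.edgeSet, 0 < kN e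
  B : F.Terminal → Set (Euc n)
  B_measurable : ∀ i, MeasurableSet (B i)
  B_subset : ∀ i, B i ⊆ Ω
  kT : F.Terminal → Euc n → ℝ
  kT_measurable : ∀ i, AEStronglyMeasurable (kT i) (volume.restrict Ω)
  kT_nonneg : ∀ i x, 0 ≤ kT i x
  kT_eq_zero : ∀ i, ∀ x ∉ B i, kT i x = 0
  kS_bounded : ∃ C : ℝ, ∀ i, ∀ x ∈ Ω, √(kT i x) ≤ C
  kS_integral : ∃ c : ℝ, 0 < c ∧ ∀ i, c ≤ ∫ x in B i, √(kT i x)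

/-- The scaled transfer coefficient `k_i^S = (k_i^T)^{1/2}`. -/
def Parameters.kS {n : ℕ} {V : Type*} {Ω : Set (Euc n)} {F : RootedForest V}
    (K : Parameters Ω F) (i : F.Terminal) (x : Euc n) : ℝ :=
  √(K.kT i x)

/-! ### Mixed-dimensional functions and operators -/

section Discrete

variable {n : ℕ} {ι V : Type*} {Ω : Set (Euc n)} {F : RootedForest V}

/-- A mixed-dimensional scalar function `[u^D, u^N]`: a function on the domain and a value at each
node that is not a Dirichlet root. -/
abbrev MDFun (n : ℕ) {V : Type*} (F : RootedForest V) : Type _ := (Euc n → ℝ) × (F.Free → ℝ)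

/-- The inner product of `L²(𝔅) = L²(Ω) × l²(𝓝 ∖ 𝓝_D)`. -/
def l2Inner [Fintype V] (Ω : Set (Euc n)) (u w : MDFun n F) : ℝ :=
  (∫ x in Ω, u.1 x * w.1 x) + ∑ i, u.2 i * w.2 i

/-- The norm of `L²(𝔅)`. -/
def l2Norm [Fintype V] (Ω : Set (Euc n)) (u : MDFun n F) : ℝ :=
  √(l2Inner Ω u u)

/-- The discrete pressures `P₀(𝓜) × l²(𝓝 ∖ 𝓝_D)`, given by their values. -/
abbrev Pressure (ι : Type*) {V : Type*} (F : RootedForest V) : Type _ := (ι → ℝ) × (F.Free → ℝ)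

/-- A discrete pressure as an element of `L²(𝔅)`. -/
def Mesh.toMDFun [Fintype ι] (M : Mesh ι Ω) (p : Pressure ι F) : MDFun n F :=
  (M.pwConst p.1, p.2)

/-- The cells of `𝓜_i = 𝓜 ∩ B_i`: the cells that meet `B_i` in a set of positive measure. -/
abbrev LocalCell (M : Mesh ι Ω) (K : Parameters Ω F) (i : F.Terminal) : Type _ :=
  {τ : ι // 0 < volume ((M.cell τ).carrier ∩ K.B i)}

/-- The discrete fluxes `H_{h,0}(div, 𝔅) = H_{h,0}(div, 𝓜) × ∏_{i ∈ 𝓝_T} P₀(𝓜_i) × l²(𝓔)`. -/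
abbrev Flux [NeZero n] (M : Mesh ι Ω) (K : Parameters Ω F) : Type _ :=
  M.RTzero × ((i : F.Terminal) → LocalCell M K i → ℝ) × F.EdgeFlux

variable [NeZero n] [Fintype ι] [Fintype V] {M : Mesh ι Ω} {K : Parameters Ω F}

/-- The (scaled) transfer flux `q_i^S` as a function on `ℝⁿ`: piecewise constant on
`𝓜_i = 𝓜 ∩ B_i`, and zero outside `B_i`. -/
def Flux.transfer (q : Flux M K) (i : F.Terminal) (x : Euc n) : ℝ :=
  ∑ τ : LocalCell M K i,
    (interior (M.cell τ).carrier ∩ K.B i).indicator (fun _ => q.2.1 i τ) x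

/-- The (scaled) mixed-dimensional divergence `[u^D, u^N]` of a flux:
`u^D = ∇ ⬝ q^D - ∑_{i ∈ 𝓝_T} k_i^S q_i^S`, and `u^N_i = -∑_{j ∈ 𝓝_i} q_{j,i}`, with the additional
term `∫_{B_i} k_i^S q_i^S` if `i` is a terminal node. -/
def Flux.mdDiv (q : Flux M K) : MDFun n F :=
  (fun x => M.glue (fun τ => divergence (q.1.1 τ)) x - ∑ i, K.kS i x * q.transfer i x,
   fun i => (if h : F.IsTerminal i.1 then ∫ x in K.B ⟨i.1, h⟩, K.kS ⟨i.1, h⟩ x *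
      q.transfer ⟨i.1, h⟩ x else 0) - ∑ j, q.2.2.1 j i.1)

/-- The constant normal component `q^D ⬝ n_f` on the facet `f` of `τ`. (Raviart-Thomas fields of
lowest order have constant normal component on each facet.) -/
def Flux.normalComp (q : Flux M K) (τ : ι) (f : (M.cell τ).Facet) : ℝ :=
  inner ℝ (q.1.1 τ ((M.cell τ).facetCenter f)) ((M.cell τ).normal f)

/-- The average of the permeability tensor on a cell. -/
def cellPermeability (M : Mesh ι Ω) (K : Parameters Ω F) (τ : ι) : Matrix (Fin n) (Fin n) ℝ :=
  Matrix.of fun i j => ⨍ x in (M.cell τ).carrier, K.kD x i j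

/-- The weight `ω_f = (k^D_τ)⁻¹ d_f / (2 |f|)` of the facet `f` of the cell `τ`, with `|f|` the
`(n-1)`-dimensional measure of `f` and `d_f` the distance between `f` and the center of `τ`; for a
tensor, `(k^D_τ)⁻¹` is taken in the direction of the normal, `n_f ⬝ (k^D_τ)⁻¹ n_f`. -/
def facetWeight (M : Mesh ι Ω) (K : Parameters Ω F) (τ : ι) (f : (M.cell τ).Facet) : ℝ :=
  (((M.cell τ).normal f).ofLp ⬝ᵥ
      (Matrix.mulVec (cellPermeability M K τ)⁻¹ ((M.cell τ).normal f).ofLp)) *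
    (Metric.infDist (M.cell τ).center ((M.cell τ).facet f) /
      (2 * (μHE[n - 1] ((M.cell τ).facet f)).toReal))

/-- The mass-lumped inner product `(q, v)_{𝔎⁻¹,h}`. In the sum over pairs of nodes each edge is
counted twice, which accounts for the factor `1/2`. -/
def lumpedInner (q v : Flux M K) : ℝ :=
  (∑ τ, ∑ f, facetWeight M K τ f * q.normalComp τ f * v.normalComp τ f) +
  (∑ i, ∫ x in K.B i, q.transfer i x * v.transfer i x) +
  2⁻¹ * ∑ i, ∑ j, (K.kN s(i, j))⁻¹ * q.2.2.1 i j * v.2.2.1 i j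

/-- `g = 𝔇_h p`: the flux `g ∈ H_{h,0}(div, 𝔅)` is the discrete gradient of the discrete pressure
`p`, that is `(g, v)_{𝔎⁻¹,h} = -(p, 𝔇 ⬝ v)` for all `v ∈ H_{h,0}(div, 𝔅)`. -/
def IsDiscreteGradient (p : Pressure ι F) (g : Flux M K) : Prop :=
  ∀ v : Flux M K, lumpedInner g v = -l2Inner Ω (M.toMDFun p) v.mdDiv

/-- The discrete gradient `𝔇_h p`. (The theorem includes that it exists and is unique.) -/
def discreteGradient (M : Mesh ι Ω) (K : Parameters Ω F) (p : Pressure ι F) : Flux M K :=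
  Classical.epsilon fun g => IsDiscreteGradient p g

/-- `(q, p)` solves the mass-lumped mixed formulation with right-hand side `r ∈ L²(𝔅)`. -/
def IsMassLumpedSolution (r : MDFun n F) (q : Flux M K) (p : Pressure ι F) : Prop :=
  (∀ v : Flux M K, lumpedInner q v - l2Inner Ω (M.toMDFun p) v.mdDiv = 0) ∧
  ∀ w : Pressure ι F, -l2Inner Ω q.mdDiv (M.toMDFun w) = -l2Inner Ω r (M.toMDFun w)

/-- `p` solves the two-point flux approximation scheme with right-hand side `r ∈ L²(𝔅)`. -/
def IsTPFASolution (M : Mesh ι Ω) (K : Parameters Ω F) (r : MDFun n F) (p : Pressure ι F) : Prop :=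
  ∀ w : Pressure ι F,
    lumpedInner (discreteGradient M K p) (discreteGradient M K w) = l2Inner Ω r (M.toMDFun w)

end Discrete

end NetworkDarcy

end

open NetworkDarcy

open MeasureTheory

noncomputable section

namespace NetworkDarcy

open scoped Classical

/-! ### Geometry of a single cell -/

namespace Cell

variable {n : ℕ}

/-! All spaces are finite dimensional, so well-posedness reduces to two definiteness statements.

The lumped form is an inner product on discrete fluxes. It is diagonal in the normal components, the
transfer values and the edge fluxes (`lumpedInner_eq`), its weights are positive (`facetWeight_pos`,
`localVolume_pos`), and a Raviart-Thomas field without normal components vanishes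
(`Cell.eq_zero_of_normal_eq_zero`). Riesz representation then yields the discrete gradient as minus
the adjoint of the divergence (`isDiscreteGradient_iff`).

The discrete gradient is injective (`pressure_eq_zero`). If it vanishes at `p`, then `p` is
orthogonal to all divergences. The basis function of a facet `f` shared by `τ` and `σ` gives `|f|
(p_τ - p_σ) = 0`; a single transfer value equates a terminal pressure with a cell pressure; a unit
flow along an edge equates its end values, with `0` at Dirichlet roots. As `Ω` is connected, shared
facets link all cells (`Mesh.eq_of_eq_on_shared`), and every tree has a terminal node, so all values
agree with the zero at a Dirichlet root.

Hence the TPFA form is positive definite and the scheme uniquely solvable. Compactness of the unit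
sphere bounds the `L²` norm by the energy norm, and testing with the solution gives stability. The
mixed formulation is the same problem before the flux is eliminated.

Simplices and parallelotopes are treated alike through `Cell.depth`, the signed distance to the
hyperplane of a facet. -/

/-- The affine basis formed by the vertices of a full-dimensional simplex. -/
def simplexBasis (s : Affine.Simplex ℝ (Euc n) n) : AffineBasis (Fin (n + 1)) ℝ (Euc n) :=
  ⟨s.points, s.independent, s.span_eq_top (by simp)⟩

@[simp] lemma simplexBasis_apply (s : Affine.Simplex ℝ (Euc n) n) (i : Fin (n + 1)) :
    simplexBasis s i = s.points i := rfl

/-- The facet of a simplex opposite to the `i`-th vertex. -/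
def opposite (s : Affine.Simplex ℝ (Euc n) n) (i : Fin (n + 1)) : (simplex s).Facet := i

/-- The facet of a parallelotope on which the `i`-th coordinate is `1` (for `t = true`) or `0`. -/
def side (b : Euc n) (e : Module.Basis (Fin n) ℝ (Euc n)) (i : Fin n) (t : Bool) :
    (box b e).Facet := (i, t)

lemma exists_opposite_eq {s : Affine.Simplex ℝ (Euc n) n} (f : (simplex s).Facet) :
    ∃ i, opposite s i = f := ⟨f, rfl⟩

lemma exists_side_eq {b : Euc n} {e : Module.Basis (Fin n) ℝ (Euc n)} (f : (box b e).Facet) :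
    ∃ i t, side b e i t = f := ⟨f.1, f.2, rfl⟩

lemma opposite_inj {s : Affine.Simplex ℝ (Euc n) n} {i j : Fin (n + 1)} :
    opposite s i = opposite s j ↔ i = j := Iff.rfl

lemma side_inj {b : Euc n} {e : Module.Basis (Fin n) ℝ (Euc n)} {i j : Fin n} {t u : Bool} :
    side b e i t = side b e j u ↔ i = j ∧ t = u := Prod.mk.injEq _ _ _ _ ▸ Iff.rfl

lemma inner_coordGrad (e : Module.Basis (Fin n) ℝ (Euc n)) (i : Fin n) (x : Euc n) :
    inner ℝ x (coordGrad e i) = e.repr x i := by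
  rw [real_inner_comm, coordGrad, InnerProductSpace.toDual_symm_apply]
  simp

lemma coordGrad_ne_zero (e : Module.Basis (Fin n) ℝ (Euc n)) (i : Fin n) :
    coordGrad e i ≠ 0 := by
  intro h
  have := inner_coordGrad e i (e i)
  simp [h] at this

lemma norm_coordGrad_pos (e : Module.Basis (Fin n) ℝ (Euc n)) (i : Fin n) :
    0 < ‖coordGrad e i‖ := norm_pos_iff.2 (coordGrad_ne_zero e i)

lemma isBounded_carrier (c : Cell n) : Bornology.IsBounded c.carrier := by
  cases c with
  | simplex s =>
    rw [carrier, ← s.convexHull_eq_closedInterior, isBounded_convexHull]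
    exact (Set.finite_range _).isBounded
  | box b e =>
    refine (Metric.isBounded_closedBall (x := b) (r := ∑ i, ‖e i‖)).subset fun x hx => ?_
    rw [mem_closedBall_iff_norm, ← e.sum_repr (x - b)]
    refine (norm_sum_le _ _).trans (Finset.sum_le_sum fun i _ => ?_)
    obtain ⟨h0, h1⟩ := hx i
    rw [norm_smul, Real.norm_of_nonneg h0]
    exact mul_le_of_le_one_left (norm_nonneg _) h1

lemma repr_center_box (b : Euc n) (e : Module.Basis (Fin n) ℝ (Euc n)) (i : Fin n) :
    e.repr ((box b e).center - b) i = 2⁻¹ := by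
  simp [center, Finsupp.single_apply]

variable [NeZero n]

/-- The signed distance of `x` to the hyperplane of the facet `f`, positive inside the cell. -/
def depth (c : Cell n) (f : c.Facet) (x : Euc n) : ℝ :=
  inner ℝ (c.facetCenter f - x) (c.normal f)

lemma depth_add (c : Cell n) (f : c.Facet) (x v : Euc n) :
    c.depth f (x + v) = c.depth f x - inner ℝ v (c.normal f) := by
  rw [depth, depth, ← sub_sub, inner_sub_left]

lemma depth_combo (c : Cell n) (f : c.Facet) (x y : Euc n) {a b : ℝ} (hab : a + b = 1) :
    c.depth f (a • x + b • y) = a * c.depth f x + b * c.depth f y := by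
  obtain rfl : a = 1 - b := by linarith
  simp only [depth, inner_sub_left, inner_add_left, real_inner_smul_left]
  ring

lemma continuous_depth (c : Cell n) (f : c.Facet) : Continuous (c.depth f) := by
  unfold depth
  fun_prop

@[simp] lemma depth_facetCenter_self (c : Cell n) (f : c.Facet) :
    c.depth f (c.facetCenter f) = 0 := by
  simp [depth]

/-- Expand `x` in barycentric coordinates: the vertices other than `i` lie in the hyperplane through
the foot orthogonal to the altitude, so only the `i`-th term survives. -/
lemma inner_sub_altitudeFoot (s : Affine.Simplex ℝ (Euc n) n) (i : Fin (n + 1)) (x : Euc n) :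
    inner ℝ (x - s.altitudeFoot i) (s.points i - s.altitudeFoot i) =
      s.height i ^ 2 * (simplexBasis s).coord i x := by
  have h1 : x - s.altitudeFoot i =
      ∑ j, (simplexBasis s).coord j x • (s.points j - s.altitudeFoot i) := by
    simp only [smul_sub, Finset.sum_sub_distrib, ← Finset.sum_smul,
      (simplexBasis s).sum_coord_apply_eq_one, one_smul]
    congr 1
    exact ((simplexBasis s).linear_combination_coord_eq_self x).symm
  rw [h1, sum_inner, Finset.sum_eq_single i]
  · rw [real_inner_smul_left, real_inner_self_eq_norm_sq, Affine.Simplex.height, dist_eq_norm,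
      mul_comm]
  · intro j _ hj
    have := s.inner_vsub_altitudeFoot_vsub_altitudeFoot_eq_zero hj.symm
    simp only [vsub_eq_sub] at this
    rw [real_inner_smul_left, this, mul_zero]
  · simp

lemma normal_simplex (s : Affine.Simplex ℝ (Euc n) n) (i : Fin (n + 1)) :
    (simplex s).normal (opposite s i) = (s.height i)⁻¹ • (s.altitudeFoot i - s.points i) := rfl

/-- Along the outward normal the `i`-th barycentric coordinate drops at rate `1 / height`, from one
at the vertex to zero at the foot of the altitude. -/
lemma inner_sub_normal_simplex (s : Affine.Simplex ℝ (Euc n) n) (i : Fin (n + 1))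
    (x y : Euc n) :
    inner ℝ (x - y) ((simplex s).normal (opposite s i)) =
      s.height i * ((simplexBasis s).coord i y - (simplexBasis s).coord i x) := by
  have hx := inner_sub_altitudeFoot s i x
  have hy := inner_sub_altitudeFoot s i y
  have hh : s.height i ≠ 0 := (s.height_pos i).ne'
  have : x - y = (x - s.altitudeFoot i) - (y - s.altitudeFoot i) := by abel
  rw [normal_simplex, real_inner_smul_right, ← neg_sub (s.points i), inner_neg_right, this,
    inner_sub_left, hx, hy]
  field_simp
  ring

lemma coord_faceOppositeCentroid (s : Affine.Simplex ℝ (Euc n) n) (i j : Fin (n + 1)) :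
    (simplexBasis s).coord j (s.faceOppositeCentroid i) = if j = i then 0 else (n : ℝ)⁻¹ := by
  have hn : (n : ℝ) ≠ 0 := Nat.cast_ne_zero.2 (NeZero.ne n)
  have hw : ∑ x ∈ ({i}ᶜ : Finset (Fin (n + 1))), (n : ℝ)⁻¹ = 1 := by
    rw [Finset.sum_const, Finset.card_compl]
    simp [hn]
  rw [s.faceOppositeCentroid_eq_affineCombination]
  split_ifs with h
  · exact (simplexBasis s).coord_apply_combination_of_notMem (by simp [h]) hw
  · exact (simplexBasis s).coord_apply_combination_of_mem (by simp [h]) hw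

lemma depth_simplex (s : Affine.Simplex ℝ (Euc n) n) (i : Fin (n + 1)) (x : Euc n) :
    (simplex s).depth (opposite s i) x = s.height i * (simplexBasis s).coord i x := by
  have := coord_faceOppositeCentroid s i i
  rw [if_pos rfl] at this
  have h : (simplex s).depth (opposite s i) x =
    inner ℝ (s.faceOppositeCentroid i - x) ((simplex s).normal (opposite s i)) := rfl
  rw [h, inner_sub_normal_simplex, this, sub_zero]

lemma normal_box (b : Euc n) (e : Module.Basis (Fin n) ℝ (Euc n)) (i : Fin n) (t : Bool) :
    (box b e).normal (side b e i t) =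
      (if t then (1 : ℝ) else -1) • (‖coordGrad e i‖⁻¹ • coordGrad e i) := rfl

lemma inner_normal_box (b : Euc n) (e : Module.Basis (Fin n) ℝ (Euc n)) (i : Fin n) (t : Bool)
    (x : Euc n) :
    inner ℝ x ((box b e).normal (side b e i t)) =
      (if t then (1 : ℝ) else -1) * (‖coordGrad e i‖⁻¹ * e.repr x i) := by
  rw [normal_box, real_inner_smul_right, real_inner_smul_right, inner_coordGrad]

lemma repr_facetCenter_box (b : Euc n) (e : Module.Basis (Fin n) ℝ (Euc n)) (i j : Fin n)
    (t : Bool) :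
    e.repr ((box b e).facetCenter (side b e i t) - b) j =
      if j = i then (if t then 1 else 0) else 2⁻¹ := by
  have h : (box b e).facetCenter (side b e i t) =
    (box b e).center + (if t then (2⁻¹ : ℝ) else -2⁻¹) • e i := rfl
  rw [h, add_sub_right_comm, map_add, Finsupp.add_apply, repr_center_box]
  cases t <;> simp [Finsupp.single_apply, eq_comm] <;> split_ifs <;> norm_num

lemma depth_box (b : Euc n) (e : Module.Basis (Fin n) ℝ (Euc n)) (i : Fin n) (t : Bool)
    (x : Euc n) :
    (box b e).depth (side b e i t) x =
      ‖coordGrad e i‖⁻¹ * (if t then 1 - e.repr (x - b) i else e.repr (x - b) i) := by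
  have : (box b e).facetCenter (side b e i t) - x =
      ((box b e).facetCenter (side b e i t) - b) - (x - b) := by abel
  have h : (box b e).depth (side b e i t) x =
    inner ℝ ((box b e).facetCenter (side b e i t) - x) ((box b e).normal (side b e i t)) := rfl
  rw [h, inner_normal_box, this, map_sub, Finsupp.sub_apply, repr_facetCenter_box, if_pos rfl]
  cases t
  · simp only [Bool.false_eq_true, if_false]
    ring
  · simp

/-- A cell is the intersection of the half spaces given by its facets. -/
lemma mem_carrier_iff (c : Cell n) (x : Euc n) : x ∈ c.carrier ↔ ∀ f, 0 ≤ c.depth f x := by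
  cases c with
  | simplex s =>
    rw [carrier, ← s.convexHull_eq_closedInterior]
    change x ∈ convexHull ℝ (Set.range (simplexBasis s)) ↔ _
    rw [(simplexBasis s).convexHull_eq_nonneg_coord, Set.mem_ofPred_eq]
    constructor
    · intro h f
      obtain ⟨i, rfl⟩ := exists_opposite_eq f
      rw [depth_simplex]
      exact mul_nonneg (s.height_pos i).le (h i)
    · intro h i
      have := h (opposite s i)
      rwa [depth_simplex, mul_nonneg_iff_of_pos_left (s.height_pos i)] at this
  | box b e =>
    have h := fun i => inv_pos.2 (norm_coordGrad_pos e i)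
    constructor
    · intro hx f
      obtain ⟨i, t, rfl⟩ := exists_side_eq f
      obtain ⟨h0, h1⟩ := hx i
      rw [depth_box]
      refine mul_nonneg (h i).le ?_
      split_ifs <;> linarith
    · intro hx i
      have h0 := hx (side b e i false)
      have h1 := hx (side b e i true)
      rw [depth_box, mul_nonneg_iff_of_pos_left (h i)] at h0 h1
      simp only [Bool.false_eq_true, if_false, if_true, sub_nonneg] at h0 h1
      exact ⟨h0, h1⟩

/-- With `mem_carrier_iff` and `mem_interior_iff`, this lets the arguments on faces and neighboring
cells work with depths alone, whatever the type of the cell. -/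
lemma mem_facet_iff (c : Cell n) (f : c.Facet) (x : Euc n) :
    x ∈ c.facet f ↔ x ∈ c.carrier ∧ c.depth f x = 0 := by
  cases c with
  | simplex s =>
    obtain ⟨k, rfl⟩ := exists_opposite_eq f
    have hk : s.height k ≠ 0 := (s.height_pos k).ne'
    have hx := (simplexBasis s).affineCombination_coord_eq_self x
    have hs := (simplexBasis s).sum_coord_apply_eq_one x
    change Finset.univ.affineCombination ℝ s.points _ = x at hx
    rw [depth_simplex, mul_eq_zero_iff_left hk, mem_carrier_iff]
    -- The opposite face has dimension `n - 1`, and `face` expects its `n` vertices counted as `n -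
    -- 1 + 1`.
    have hcard : ({k}ᶜ : Finset (Fin (n + 1))).card = n - 1 + 1 := by
      have := NeZero.one_le (n := n)
      simp only [Finset.card_compl, Fintype.card_fin, Finset.card_singleton]
      lia
    change x ∈ (s.face hcard).closedInterior ↔ _
    conv_lhs => rw [← hx]
    rw [s.affineCombination_mem_closedInterior_face_iff_nonneg _ hs]
    constructor
    · rintro ⟨h0, h1⟩
      have h2 : (simplexBasis s).coord k x = 0 := h1 k (by simp)
      refine ⟨fun f => ?_, h2⟩
      obtain ⟨i, rfl⟩ := exists_opposite_eq f
      rw [depth_simplex]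
      by_cases hi : i = k
      · rw [hi, h2, mul_zero]
      · exact mul_nonneg (s.height_pos i).le (h0 i (by simpa using hi))
    · rintro ⟨h0, h1⟩
      refine ⟨fun i _ => ?_, fun i hi => ?_⟩
      · have := h0 (opposite s i)
        rwa [depth_simplex, mul_nonneg_iff_of_pos_left (s.height_pos i)] at this
      · obtain rfl : i = k := by simpa using hi
        exact h1
  | box b e =>
    obtain ⟨i, t, rfl⟩ := exists_side_eq f
    have h := (inv_pos.2 (norm_coordGrad_pos e i)).ne'
    rw [depth_box, mul_eq_zero_iff_left h]
    change x ∈ (box b e).carrier ∧ e.repr (x - b) i = (if t then 1 else 0) ↔ _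
    refine and_congr_right fun _ => ?_
    cases t
    · simp
    · simp only [if_true, sub_eq_zero]
      exact eq_comm

lemma depth_center_pos (c : Cell n) (f : c.Facet) : 0 < c.depth f c.center := by
  cases c with
  | simplex s =>
    obtain ⟨k, rfl⟩ := exists_opposite_eq f
    rw [depth_simplex]
    refine mul_pos (s.height_pos _) ?_
    have := (simplexBasis s).coord_apply_centroid (Finset.mem_univ k)
    change (simplexBasis s).coord k s.centroid = _ at this
    change 0 < (simplexBasis s).coord k s.centroid
    rw [this]
    simp only [Finset.card_univ, Fintype.card_fin]
    positivity
  | box b e =>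
    obtain ⟨i, t, rfl⟩ := exists_side_eq f
    rw [depth_box, repr_center_box]
    refine mul_pos (inv_pos.2 (norm_coordGrad_pos e i)) ?_
    split_ifs <;> norm_num

lemma depth_facetCenter_pos (c : Cell n) {f g : c.Facet} (h : g ≠ f) :
    0 < c.depth g (c.facetCenter f) := by
  cases c with
  | simplex s =>
    obtain ⟨i, rfl⟩ := exists_opposite_eq f
    obtain ⟨j, rfl⟩ := exists_opposite_eq g
    rw [depth_simplex]
    change 0 < s.height j * (simplexBasis s).coord j (s.faceOppositeCentroid i)
    rw [coord_faceOppositeCentroid, if_neg (mt opposite_inj.2 h)]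
    exact mul_pos (s.height_pos _) (inv_pos.2 (Nat.cast_pos.2 (NeZero.pos n)))
  | box b e =>
    obtain ⟨i, t, rfl⟩ := exists_side_eq f
    obtain ⟨j, u, rfl⟩ := exists_side_eq g
    rw [depth_box, repr_facetCenter_box]
    refine mul_pos (inv_pos.2 (norm_coordGrad_pos e j)) ?_
    by_cases hij : j = i
    · subst hij
      cases t <;> cases u <;> first | exact absurd rfl h | simp
    · rw [if_neg hij]
      split_ifs <;> norm_num

lemma norm_normal (c : Cell n) (f : c.Facet) : ‖c.normal f‖ = 1 := by
  cases c with
  | simplex s =>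
    obtain ⟨i, rfl⟩ := exists_opposite_eq f
    have := s.height_pos i
    rw [normal_simplex, norm_smul, norm_inv, Real.norm_of_nonneg this.le, ← dist_eq_norm, dist_comm]
    exact inv_mul_cancel₀ this.ne'
  | box b e =>
    obtain ⟨i, t, rfl⟩ := exists_side_eq f
    have := norm_coordGrad_pos e i
    rw [normal_box, norm_smul, norm_smul, norm_inv, norm_norm, inv_mul_cancel₀ this.ne']
    cases t <;> simp

/-! ### Topology, interior and volume of a cell. -/

lemma isClosed_carrier (c : Cell n) : IsClosed c.carrier := by
  have : c.carrier = ⋂ f, {x | 0 ≤ c.depth f x} := by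
    ext x
    simp [mem_carrier_iff]
  rw [this]
  exact isClosed_iInter fun f => isClosed_le continuous_const (c.continuous_depth f)

lemma isCompact_carrier (c : Cell n) : IsCompact c.carrier :=
  Metric.isCompact_of_isClosed_isBounded c.isClosed_carrier c.isBounded_carrier

lemma convex_carrier (c : Cell n) : Convex ℝ c.carrier := by
  intro x hx y hy a b ha hb hab
  rw [mem_carrier_iff] at *
  intro f
  rw [depth_combo _ _ _ _ hab]
  exact add_nonneg (mul_nonneg ha (hx f)) (mul_nonneg hb (hy f))

lemma isOpen_depth_pos (c : Cell n) : IsOpen {x | ∀ f, 0 < c.depth f x} := by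
  simp only [Set.ofPred_forall]
  exact isOpen_iInter_of_finite fun f => isOpen_lt continuous_const (c.continuous_depth f)

lemma mem_interior_iff (c : Cell n) (x : Euc n) :
    x ∈ interior c.carrier ↔ ∀ f, 0 < c.depth f x := by
  constructor
  · intro hx f
    -- A small step `t > 0` along the outward normal stays in the cell and lowers the depth by `t`,
    -- so the depth at `x` is at least `t`.
    have hc : ContinuousAt (fun t : ℝ => x + t • c.normal f) 0 := by fun_prop
    have h0 : x + (0 : ℝ) • c.normal f ∈ interior c.carrier := by simpa using hx
    have hev := hc.eventually (isOpen_interior.mem_nhds h0)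
    obtain ⟨t, ht, ht0⟩ := ((hev.filter_mono nhdsWithin_le_nhds).and
      (self_mem_nhdsWithin : Set.Ioi (0 : ℝ) ∈ nhdsWithin 0 (Set.Ioi 0))).exists
    have := (c.mem_carrier_iff _).1 (interior_subset ht) f
    rw [depth_add, real_inner_smul_left, real_inner_self_eq_norm_sq, norm_normal] at this
    have ht0 : 0 < t := ht0
    nlinarith
  · intro hx
    exact interior_maximal (fun y hy => (c.mem_carrier_iff y).2 fun f => (hy f).le)
      c.isOpen_depth_pos hx

lemma center_mem_interior (c : Cell n) : c.center ∈ interior c.carrier :=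
  (c.mem_interior_iff _).2 c.depth_center_pos

lemma facetCenter_mem_facet (c : Cell n) (f : c.Facet) : c.facetCenter f ∈ c.facet f := by
  refine (c.mem_facet_iff _ _).2 ⟨(c.mem_carrier_iff _).2 fun g => ?_, c.depth_facetCenter_self f⟩
  by_cases h : g = f
  · rw [h, depth_facetCenter_self]
  · exact (c.depth_facetCenter_pos h).le

/-- The center of a facet lies on no other facet. Equality of facets as sets thus identifies their
indices. -/
lemma facet_injective (c : Cell n) : Function.Injective c.facet := by
  intro f g h
  by_contra hne
  have h1 := c.facetCenter_mem_facet g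
  rw [← h, mem_facet_iff] at h1
  exact (c.depth_facetCenter_pos hne).ne' h1.2

lemma isClosed_facet (c : Cell n) (f : c.Facet) : IsClosed (c.facet f) := by
  have : c.facet f = c.carrier ∩ {x | c.depth f x = 0} := by
    ext x
    simp [mem_facet_iff]
  rw [this]
  exact c.isClosed_carrier.inter (isClosed_eq (c.continuous_depth f) continuous_const)

lemma infDist_center_facet_pos (c : Cell n) (f : c.Facet) :
    0 < Metric.infDist c.center (c.facet f) := by
  rw [← (c.isClosed_facet f).notMem_iff_infDist_pos ⟨_, c.facetCenter_mem_facet f⟩]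
  intro h
  exact (c.depth_center_pos f).ne' ((c.mem_facet_iff _ _).1 h).2

lemma volume_frontier_carrier (c : Cell n) : volume (frontier c.carrier) = 0 :=
  c.convex_carrier.addHaar_frontier volume

lemma volume_interior_carrier (c : Cell n) : volume (interior c.carrier) = volume c.carrier :=
  measure_interior_of_null_frontier c.volume_frontier_carrier

lemma volume_carrier_pos (c : Cell n) : 0 < volume c.carrier := by
  rw [← volume_interior_carrier]
  exact isOpen_interior.measure_pos _ ⟨_, c.center_mem_interior⟩

lemma volume_carrier_lt_top (c : Cell n) : volume c.carrier < ⊤ :=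
  c.isCompact_carrier.measure_lt_top

end Cell

/-! ### The local Raviart-Thomas element -/

lemma divergence_eq_of_affine {n : ℕ} {q : Euc n → Euc n} {L : Euc n →L[ℝ] Euc n}
    (h : ∀ x, q x = q 0 + L x) (x : Euc n) :
    divergence q x = ∑ i, (L (EuclideanSpace.single i 1)) i := by
  have hq : HasFDerivAt q L x := by
    rw [show q = fun x => q 0 + L x from funext h]
    exact L.hasFDerivAt.const_add _
  rw [divergence, hq.fderiv]

namespace Cell

variable {n : ℕ}

/-- Raviart-Thomas fields of lowest order are affine. -/
lemma exists_linear_of_mem_RT0 {c : Cell n} {q : Euc n → Euc n} (hq : q ∈ c.RT0) :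
    ∃ L : Euc n →L[ℝ] Euc n, ∀ x, q x = q 0 + L x := by
  cases c with
  | simplex s =>
    obtain ⟨a, r, h⟩ := hq
    exact ⟨r • ContinuousLinearMap.id ℝ _, fun x => by simp [h]⟩
  | box b e =>
    obtain ⟨a, r, h⟩ := hq
    refine ⟨∑ i, r i • (LinearMap.toContinuousLinearMap (e.coord i)).smulRight (e i), fun x => ?_⟩
    simp only [h, sum_apply, smul_apply,
      ContinuousLinearMap.smulRight_apply, LinearMap.coe_toContinuousLinearMap', e.coord_apply]
    rw [← Finset.sum_add_distrib]
    refine Finset.sum_congr rfl fun i _ => ?_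
    rw [smul_smul, ← add_smul, map_sub, map_sub, map_zero]
    simp only [Finsupp.sub_apply, Finsupp.zero_apply]
    ring_nf

lemma divergence_eq_const {c : Cell n} {q : Euc n → Euc n} (hq : q ∈ c.RT0) (x : Euc n) :
    divergence q x = divergence q 0 := by
  obtain ⟨L, hL⟩ := exists_linear_of_mem_RT0 hq
  rw [divergence_eq_of_affine hL, divergence_eq_of_affine hL]

lemma differentiable_of_mem_RT0 {c : Cell n} {q : Euc n → Euc n} (hq : q ∈ c.RT0) :
    Differentiable ℝ q := by
  obtain ⟨L, hL⟩ := exists_linear_of_mem_RT0 hq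
  rw [show q = fun x => q 0 + L x from funext hL]
  fun_prop

lemma divergence_add {c : Cell n} {q q' : Euc n → Euc n} (hq : q ∈ c.RT0) (hq' : q' ∈ c.RT0)
    (x : Euc n) : divergence (q + q') x = divergence q x + divergence q' x := by
  simp only [divergence, fderiv_add (differentiable_of_mem_RT0 hq x)
    (differentiable_of_mem_RT0 hq' x), add_apply, PiLp.add_apply,
    Finset.sum_add_distrib]

lemma divergence_smul {c : Cell n} {q : Euc n → Euc n} (hq : q ∈ c.RT0) (r : ℝ) (x : Euc n) :
    divergence (r • q) x = r * divergence q x := by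
  simp only [divergence, fderiv_const_smul (differentiable_of_mem_RT0 hq x),
    smul_apply, PiLp.smul_apply, smul_eq_mul, Finset.mul_sum]

variable [NeZero n]

/-- Raviart-Thomas fields of lowest order are determined by their normal components. -/
lemma eq_zero_of_normal_eq_zero {c : Cell n} {q : Euc n → Euc n} (hq : q ∈ c.RT0)
    (h : ∀ f, inner ℝ (q (c.facetCenter f)) (c.normal f) = 0) : q = 0 := by
  cases c with
  | simplex s =>
    obtain ⟨a, r, hq⟩ := hq
    -- From the center of facet `i` to a vertex `j ≠ i` the field changes by a multiple of the
    -- displacement, which is tangent to the facet; the normal component stays zero.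
    have hn : ∀ i j, j ≠ i → inner ℝ (q (s.points j)) ((simplex s).normal (opposite s i)) = 0 := by
      intro i j hij
      have h1 : q (s.points j) = q (s.faceOppositeCentroid i) +
          r • (s.points j - s.faceOppositeCentroid i) := by
        rw [hq, hq, smul_sub]
        abel
      have h2 : inner ℝ (q (s.faceOppositeCentroid i)) ((simplex s).normal (opposite s i)) = 0 :=
        h (opposite s i)
      have h3 := (simplexBasis s).coord_apply_ne hij.symm
      rw [simplexBasis_apply] at h3
      rw [h1, inner_add_left, h2, real_inner_smul_left, inner_sub_normal_simplex,
        coord_faceOppositeCentroid, if_pos rfl, h3]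
      simp
    -- Adding the field value to vertex `j` changes no coordinate `i ≠ j`, hence not coordinate `j`
    -- either, since the coordinates sum to one. So the value is zero.
    have hv : ∀ j, q (s.points j) = 0 := by
      intro j
      have hc : ∀ i, i ≠ j → (simplexBasis s).coord i (s.points j + q (s.points j)) =
          (simplexBasis s).coord i (s.points j) := by
        intro i hij
        have h1 := inner_sub_normal_simplex s i (s.points j + q (s.points j)) (s.points j)
        rw [add_sub_cancel_left, hn i j hij.symm] at h1
        have := (mul_eq_zero.1 h1.symm).resolve_left (s.height_pos i).ne'
        linarith
      have hj : (simplexBasis s).coord j (s.points j + q (s.points j)) =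
          (simplexBasis s).coord j (s.points j) := by
        have h1 := (simplexBasis s).sum_coord_apply_eq_one (s.points j + q (s.points j))
        have h2 := (simplexBasis s).sum_coord_apply_eq_one (s.points j)
        rw [← Finset.add_sum_erase _ _ (Finset.mem_univ j)] at h1 h2
        rw [Finset.sum_congr rfl fun i hi => hc i (Finset.ne_of_mem_erase hi)] at h1
        linarith
      have := (simplexBasis s).ext_elem (q₁ := s.points j + q (s.points j)) (q₂ := s.points j)
        fun i => by
          by_cases hij : i = j
          · rw [hij, hj]
          · exact hc i hij
      simpa using this
    -- A field `a + r x` that vanishes at two different points is zero; `n ≥ 1` provides two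
    -- vertices.
    have hne : s.points 0 ≠ s.points 1 :=
      s.independent.injective.ne (by
        have := NeZero.one_le (n := n)
        rw [ne_eq, Fin.ext_iff, Fin.val_zero, Fin.val_one', Nat.mod_eq_of_lt (by lia)]
        simp)
    have h0 := hv 0
    have h1 := hv 1
    rw [hq] at h0 h1
    have hr : r = 0 := by
      have : r • (s.points 0 - s.points 1) = 0 := by
        rw [smul_sub, sub_eq_zero]
        exact add_left_cancel (h0.trans h1.symm)
      exact (smul_eq_zero.1 this).resolve_right (sub_ne_zero.2 hne)
    have ha : a = 0 := by simpa [hr] using h0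
    funext x
    simp [hq, hr, ha]
  | box b e =>
    obtain ⟨a, r, hq⟩ := hq
    -- The two opposite sides in direction `i` give the values at `0` and `1` of the affine
    -- coefficient of `e i`.
    have hc : ∀ (i : Fin n) (t : Bool), a i + r i * (if t then 1 else 0) = 0 := by
      intro i t
      have h1 := h (side b e i t)
      rw [inner_normal_box, hq, e.repr_sum_self, repr_facetCenter_box, if_pos rfl] at h1
      have h2 := (inv_pos.2 (norm_coordGrad_pos e i)).ne'
      have h3 : (if t then (1 : ℝ) else -1) ≠ 0 := by split_ifs <;> norm_num
      simpa only [mul_eq_zero, h2, h3, false_or] using h1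
    have ha : ∀ i, a i = 0 := fun i => by simpa using hc i false
    have hr : ∀ i, r i = 0 := fun i => by simpa [ha] using hc i true
    funext x
    simp [hq, ha, hr]

/-- The Raviart-Thomas basis function of a facet: its normal component is `1` on that facet and `0`
on the others. -/
def shape : (c : Cell n) → c.Facet → Euc n → Euc n
  | simplex s, i => fun x => (s.height i)⁻¹ • (x - s.points i)
  | box b e, (i, t) => fun x =>
      (‖coordGrad e i‖ * (e.repr (x - b) i - if t then 0 else 1)) • e i

lemma shape_simplex (s : Affine.Simplex ℝ (Euc n) n) (i : Fin (n + 1)) (x : Euc n) :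
    (simplex s).shape (opposite s i) x = (s.height i)⁻¹ • (x - s.points i) := rfl

lemma shape_box (b : Euc n) (e : Module.Basis (Fin n) ℝ (Euc n)) (i : Fin n) (t : Bool)
    (x : Euc n) : (box b e).shape (side b e i t) x =
      (‖coordGrad e i‖ * (e.repr (x - b) i - if t then 0 else 1)) • e i := rfl

lemma shape_mem_RT0 (c : Cell n) (f : c.Facet) : c.shape f ∈ c.RT0 := by
  cases c with
  | simplex s =>
    obtain ⟨i, rfl⟩ := exists_opposite_eq f
    refine ⟨-((s.height i)⁻¹ • s.points i), (s.height i)⁻¹, fun x => ?_⟩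
    rw [shape_simplex, smul_sub]
    abel
  | box b e =>
    obtain ⟨i, t, rfl⟩ := exists_side_eq f
    refine ⟨Pi.single i (-(‖coordGrad e i‖ * if t then 0 else 1)), Pi.single i ‖coordGrad e i‖,
      fun x => ?_⟩
    rw [shape_box, Finset.sum_eq_single i]
    · simp only [Pi.single_eq_same]
      ring_nf
    · intro j _ hj
      simp [hj]
    · simp

/-- On a simplex, `x - p_i` is tangent to the facets through `p_i` and has normal component `height
i` on the opposite one. On a parallelotope, `e i` is tangent to the sides of other directions and
its coefficient vanishes on the opposite side. -/
lemma inner_shape_normal (c : Cell n) (f g : c.Facet) {x : Euc n} (hx : c.depth g x = 0) :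
    inner ℝ (c.shape f x) (c.normal g) = if f = g then 1 else 0 := by
  cases c with
  | simplex s =>
    obtain ⟨i, rfl⟩ := exists_opposite_eq f
    obtain ⟨j, rfl⟩ := exists_opposite_eq g
    have hj := (s.height_pos j).ne'
    rw [depth_simplex, mul_eq_zero_iff_left hj] at hx
    rw [shape_simplex, real_inner_smul_left, inner_sub_normal_simplex, hx, ← simplexBasis_apply,
      AffineBasis.coord_apply, opposite_inj]
    by_cases hij : i = j
    · subst hij
      simp [hj]
    · simp [hij, Ne.symm hij]
  | box b e =>
    obtain ⟨i, t, rfl⟩ := exists_side_eq f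
    obtain ⟨j, u, rfl⟩ := exists_side_eq g
    have hj := (norm_coordGrad_pos e j).ne'
    rw [depth_box, mul_eq_zero_iff_left (inv_ne_zero hj)] at hx
    rw [shape_box, real_inner_smul_left, inner_normal_box, side_inj, e.repr_self,
      Finsupp.single_apply]
    by_cases hij : i = j
    · subst hij
      have hx' : e.repr (x - b) i = if u then 1 else 0 := by
        cases u
        · simpa only [Bool.false_eq_true, if_false] using hx
        · simp only [if_true] at hx ⊢
          linarith
      rw [hx']
      cases t <;> cases u <;> simp [hj]
    · simp [hij]

/-- The divergence of the basis function of a facet. -/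
lemma divergence_shape_simplex (s : Affine.Simplex ℝ (Euc n) n) (i : Fin (n + 1)) (x : Euc n) :
    divergence ((simplex s).shape (opposite s i)) x = n * (s.height i)⁻¹ := by
  rw [divergence_eq_of_affine (L := (s.height i)⁻¹ • ContinuousLinearMap.id ℝ _)]
  · simp
  · intro x
    rw [shape_simplex, shape_simplex]
    simp [smul_sub]
    abel

lemma divergence_shape_box (b : Euc n) (e : Module.Basis (Fin n) ℝ (Euc n)) (i : Fin n) (t : Bool)
    (x : Euc n) : divergence ((box b e).shape (side b e i t)) x = ‖coordGrad e i‖ := by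
  rw [divergence_eq_of_affine (L := ‖coordGrad e i‖ •
    (LinearMap.toContinuousLinearMap (e.coord i)).smulRight (e i))]
  -- The trace of the rank-one map `x ↦ (coordinate i of x) • e i` is the `i`-th coordinate of `e
  -- i`, that is `1`.
  · have h1 : e i = ∑ k, (e i) k • EuclideanSpace.single k (1 : ℝ) := by
      ext k
      simp [Pi.single_apply]
    have h2 : ∑ k, (e i) k * e.repr (EuclideanSpace.single k (1 : ℝ)) i = 1 := by
      have := congrArg (fun v => e.repr v i) h1
      simp only [map_sum, map_smul, Finsupp.coe_finsetSum, Finset.sum_apply, Finsupp.smul_apply,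
        smul_eq_mul, e.repr_self, Finsupp.single_eq_same] at this
      exact this.symm
    simp only [smul_apply, ContinuousLinearMap.smulRight_apply,
      LinearMap.coe_toContinuousLinearMap', e.coord_apply, PiLp.smul_apply, smul_eq_mul]
    rw [← Finset.mul_sum]
    simp_rw [mul_comm (e.repr _ i)]
    rw [h2, mul_one]
  · intro x
    rw [shape_box, shape_box]
    simp only [smul_apply, ContinuousLinearMap.smulRight_apply,
      LinearMap.coe_toContinuousLinearMap', e.coord_apply, smul_smul, ← add_smul, map_sub,
      map_zero, Finsupp.sub_apply, Finsupp.zero_apply]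
    ring_nf

/-! ### Volume of a cell and measure of its facets -/

/-- Cavalieri's principle along the inward unit normal, based at the facet center so that the slice
parameter is the depth. -/
lemma volume_carrier_eq_lintegral (c : Cell n) (f : c.Facet) :
    volume c.carrier = ∫⁻ t : ℝ, μHE[n - 1] {x ∈ c.carrier | c.depth f x = t} := by
  have hv : -c.normal f ≠ 0 := by
    rw [neg_ne_zero, ← norm_ne_zero_iff, norm_normal]
    exact one_ne_zero
  have h := EuclideanGeometry.euclideanHausdorffMeasure_eq_lintegral (c.facetCenter f) hv
    c.isClosed_carrier.measurableSet
  rw [finrank_euclideanSpace_fin, EuclideanSpace.euclideanHausdorffMeasure_eq_volume] at h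
  rw [h, ← ofReal_norm, norm_neg, norm_normal, ENNReal.ofReal_one, one_mul]
  refine lintegral_congr fun t => ?_
  congr 1
  ext x
  simp only [Set.mem_inter_iff, SetLike.mem_coe, AffineSubspace.mem_mk', Set.mem_ofPred_eq,
    Submodule.mem_orthogonal_singleton_iff_inner_right, vsub_eq_sub, vadd_eq_add]
  refine and_congr_right fun _ => ?_
  have : inner ℝ (-c.normal f) (x - (t • -c.normal f + c.facetCenter f)) = c.depth f x - t := by
    rw [real_inner_comm, depth]
    simp only [inner_sub_left, inner_add_left, real_inner_smul_left, inner_neg_right,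
      inner_neg_left, real_inner_self_eq_norm_sq, norm_normal]
    ring
  rw [this, sub_eq_zero]

/-- The volume of a cell whose cross sections parallel to the facet `f` are scaled copies
of `f`. -/
lemma volume_carrier_eq_of_slices (c : Cell n) (f : c.Facet) {h : ℝ} (hh : 0 ≤ h) {w : ℝ → ℝ}
    (hw : Continuous w) (hw0 : ∀ t ∈ Set.Ioo 0 h, 0 ≤ w t)
    (hle : ∀ x ∈ c.carrier, c.depth f x ≤ h)
    (hs : ∀ t ∈ Set.Ioo 0 h, μHE[n - 1] {x ∈ c.carrier | c.depth f x = t} =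
      ENNReal.ofReal (w t) * μHE[n - 1] (c.facet f)) :
    volume c.carrier = ENNReal.ofReal (∫ t in 0..h, w t) * μHE[n - 1] (c.facet f) := by
  have hi : IntegrableOn w (Set.Ioo 0 h) :=
    (hw.integrableOn_Icc).mono_set Set.Ioo_subset_Icc_self
  rw [c.volume_carrier_eq_lintegral f]
  calc _ = ∫⁻ t, (Set.Ioo 0 h).indicator
        (fun t => ENNReal.ofReal (w t) * μHE[n - 1] (c.facet f)) t := by
        refine lintegral_congr_ae ?_
        -- Slices outside `[0, h]` are empty and the two end values form a null set, so only the
        -- open interval contributes.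
        have hne : ∀ᵐ t : ℝ, t ∉ ({0, h} : Set ℝ) :=
          measure_eq_zero_iff_ae_notMem.1 ((Set.toFinite _).measure_zero _)
        filter_upwards [hne] with t ht
        by_cases hth : t ∈ Set.Ioo 0 h
        · rw [Set.indicator_of_mem hth, hs t hth]
        · rw [Set.indicator_of_notMem hth]
          convert! measure_empty (μ := μHE[n - 1])
          refine Set.eq_empty_of_forall_notMem fun x hx => hth ?_
          have h0 := (c.mem_carrier_iff x).1 hx.1 f
          have h1 := hle x hx.1
          rw [hx.2] at h0 h1
          simp only [Set.mem_insert_iff, Set.mem_singleton_iff, not_or] at ht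
          exact ⟨lt_of_le_of_ne h0 (Ne.symm ht.1), lt_of_le_of_ne h1 ht.2⟩
    _ = _ := by
        rw [lintegral_indicator measurableSet_Ioo, lintegral_mul_const _ (by fun_prop),
          intervalIntegral.integral_of_le hh, integral_Ioc_eq_integral_Ioo,
          ofReal_integral_eq_lintegral_ofReal hi
            ((ae_restrict_iff' measurableSet_Ioo).2 (Filter.Eventually.of_forall hw0))]

/-- The slice at depth `t` is the facet shrunk towards the opposite vertex by `r = 1 - t / height`.
Its measure scales with `r ^ (n - 1)`, whose integral over the height is `height / n`. -/
lemma volume_simplex (s : Affine.Simplex ℝ (Euc n) n) (i : Fin (n + 1)) :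
    volume (simplex s).carrier = ENNReal.ofReal (s.height i / n) *
      μHE[n - 1] ((simplex s).facet (opposite s i)) := by
  have hh := s.height_pos i
  have hn : (n : ℝ) ≠ 0 := Nat.cast_ne_zero.2 (NeZero.ne n)
  have hint : ∫ t in 0..s.height i, (1 - t / s.height i) ^ (n - 1) = s.height i / n := by
    rw [intervalIntegral.integral_comp_sub_div (fun x => x ^ (n - 1)) hh.ne', integral_pow]
    have := NeZero.one_le (n := n)
    have h2 : n - 1 + 1 = n := by lia
    have h3 : ((n - 1 : ℕ) : ℝ) + 1 = n := by exact_mod_cast h2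
    rw [h2, h3, div_self hh.ne', zero_div]
    simp [NeZero.ne n]
    ring
  have hP : ∀ j, (simplex s).depth (opposite s j) (s.points i) =
      if j = i then s.height i else 0 := by
    intro j
    rw [depth_simplex, ← simplexBasis_apply, AffineBasis.coord_apply]
    split_ifs with h
    · rw [h, mul_one]
    · rw [mul_zero]
  rw [← hint]
  refine volume_carrier_eq_of_slices _ _ hh.le (by fun_prop) ?_ ?_ ?_
  · rintro t ⟨ht0, hth⟩
    exact pow_nonneg (sub_nonneg.2 ((div_le_one hh).2 hth.le)) _
  · intro x hx
    rw [depth_simplex]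
    refine mul_le_of_le_one_right hh.le ?_
    rw [← (simplexBasis s).sum_coord_apply_eq_one x]
    refine Finset.single_le_sum (f := fun j => (simplexBasis s).coord j x) (fun j _ => ?_)
      (Finset.mem_univ i)
    have := ((simplex s).mem_carrier_iff x).1 hx (opposite s j)
    rwa [depth_simplex, mul_nonneg_iff_of_pos_left (s.height_pos j)] at this
  · rintro t ⟨ht0, hth⟩
    set r := 1 - t / s.height i with hr
    have hr0 : 0 < r := sub_pos.2 ((div_lt_one hh).2 hth)
    have hrt : (1 - r) * s.height i = t := by
      rw [hr]
      field_simp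
      ring
    have himg : {x ∈ (simplex s).carrier | (simplex s).depth (opposite s i) x = t} =
        AffineMap.homothety (s.points i) r '' (simplex s).facet (opposite s i) := by
      -- The homothety fixes vertex `i`, which has depth `height` for facet `i` and zero for the
      -- others; depths are affine and `(1 - r) * height = t`.
      have hd : ∀ j y, (simplex s).depth (opposite s j) (AffineMap.homothety (s.points i) r y) =
          (if j = i then t else 0) + r * (simplex s).depth (opposite s j) y := by
        intro j y
        have : AffineMap.homothety (s.points i) r y = (1 - r) • s.points i + r • y := by
          rw [AffineMap.homothety_apply, vsub_eq_sub, vadd_eq_add]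
          module
        rw [this, depth_combo _ _ _ _ (by ring), hP]
        split_ifs
        · rw [hrt]
        · simp
      ext x
      constructor
      · rintro ⟨hx, hxt⟩
        have hxy : AffineMap.homothety (s.points i) r
            (AffineMap.homothety (s.points i) r⁻¹ x) = x := by
          rw [← AffineMap.comp_apply, ← AffineMap.homothety_mul, mul_inv_cancel₀ hr0.ne',
            AffineMap.homothety_one, AffineMap.id_apply]
        refine ⟨AffineMap.homothety (s.points i) r⁻¹ x, ?_, hxy⟩
        generalize AffineMap.homothety (s.points i) r⁻¹ x = y at hxy
        subst hxy
        rw [hd, if_pos rfl, add_eq_left, mul_eq_zero_iff_left hr0.ne'] at hxt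
        refine ((simplex s).mem_facet_iff _ _).2
          ⟨((simplex s).mem_carrier_iff _).2 fun f => ?_, hxt⟩
        obtain ⟨j, rfl⟩ := exists_opposite_eq f
        by_cases hj : j = i
        · rw [hj, hxt]
        · have := ((simplex s).mem_carrier_iff _).1 hx (opposite s j)
          rwa [hd, if_neg hj, zero_add, mul_nonneg_iff_of_pos_left hr0] at this
      · rintro ⟨y, hy, rfl⟩
        obtain ⟨hy, hy0⟩ := ((simplex s).mem_facet_iff _ _).1 hy
        refine ⟨((simplex s).mem_carrier_iff _).2 fun f => ?_, ?_⟩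
        · obtain ⟨j, rfl⟩ := exists_opposite_eq f
          rw [hd]
          refine add_nonneg (by split_ifs <;> linarith)
            (mul_nonneg hr0.le (((simplex s).mem_carrier_iff _).1 hy _))
        · rw [hd, hy0, if_pos rfl, mul_zero, add_zero]
    rw [himg, euclideanHausdorffMeasure_homothety_image _ _ hr0.ne', ENNReal.smul_def, smul_eq_mul]
    congr 1
    rw [ENNReal.ofReal_pow hr0.le, ENNReal.coe_pow, ← enorm_eq_nnnorm, Real.enorm_eq_ofReal hr0.le]

/-- All slices parallel to a side are translates of it, and the width between opposite sides is
`‖coordGrad e i‖⁻¹`. -/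
lemma volume_box (b : Euc n) (e : Module.Basis (Fin n) ℝ (Euc n)) (i : Fin n) (u : Bool) :
    volume (box b e).carrier = ENNReal.ofReal ‖coordGrad e i‖⁻¹ *
      μHE[n - 1] ((box b e).facet (side b e i u)) := by
  have hg := norm_coordGrad_pos e i
  have hint : ∫ t in 0..‖coordGrad e i‖⁻¹, (1 : ℝ) = ‖coordGrad e i‖⁻¹ := by simp
  rw [← hint]
  refine volume_carrier_eq_of_slices _ _ (inv_pos.2 hg).le continuous_const
    (fun _ _ => zero_le_one) ?_ ?_
  · intro x hx
    obtain ⟨h0, h1⟩ := hx i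
    rw [depth_box]
    refine mul_le_of_le_one_right (inv_pos.2 hg).le ?_
    split_ifs <;> linarith
  · rintro t ⟨ht0, hth⟩
    have htg : 0 < ‖coordGrad e i‖ * t := mul_pos hg ht0
    have htg1 : ‖coordGrad e i‖ * t < 1 := by
      rwa [← mul_one ‖_‖⁻¹, lt_inv_mul_iff₀ hg] at hth
    -- The shift along `e i` into the cell that raises the depth by `t`; its sign depends on which
    -- of the two sides is the base.
    set v : Euc n := ((if u then (-1 : ℝ) else 1) * (‖coordGrad e i‖ * t)) • e i with hv
    have hrepr : ∀ y j, e.repr (v + y - b) j = e.repr (y - b) j +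
        if j = i then ((if u then (-1 : ℝ) else 1) * (‖coordGrad e i‖ * t)) else 0 := by
      intro y j
      rw [add_sub_assoc, map_add, Finsupp.add_apply, hv, map_smul, e.repr_self, Finsupp.smul_apply,
        Finsupp.single_apply, add_comm]
      simp [eq_comm]
    have hfac : ∀ y, y ∈ (box b e).facet (side b e i u) ↔
      y ∈ (box b e).carrier ∧ e.repr (y - b) i = if u then 1 else 0 := fun y => Iff.rfl
    have hdep : ∀ y, (box b e).depth (side b e i u) y = t ↔
        e.repr (y - b) i = if u then 1 - ‖coordGrad e i‖ * t else ‖coordGrad e i‖ * t := by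
      intro y
      rw [depth_box, inv_mul_eq_iff_eq_mul₀ hg.ne']
      cases u
      · simp
      · simp only [if_true]
        constructor <;> intro h <;> linarith
    have himg : {x ∈ (box b e).carrier | (box b e).depth (side b e i u) x = t} =
        (fun y => v + y) '' (box b e).facet (side b e i u) := by
      ext x
      constructor
      · rintro ⟨hx, hxt⟩
        refine ⟨x - v, ?_, add_sub_cancel _ _⟩
        obtain ⟨y, rfl⟩ : ∃ y, x = v + y := ⟨x - v, by abel⟩
        rw [add_sub_cancel_left]
        rw [hdep, hrepr, if_pos rfl] at hxt
        have hy : e.repr (y - b) i = if u then 1 else 0 := by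
          cases u
          · simp only [Bool.false_eq_true, if_false] at hxt ⊢
            linarith
          · simp only [if_true] at hxt ⊢
            linarith
        refine (hfac y).2 ⟨fun j => ?_, hy⟩
        by_cases hj : j = i
        · rw [hj, hy]
          cases u <;> simp
        · have := hx j
          rwa [hrepr, if_neg hj, add_zero] at this
      · rintro ⟨y, hy, rfl⟩
        obtain ⟨hy, hy0⟩ := (hfac y).1 hy
        have hi : e.repr (v + y - b) i =
            if u then 1 - ‖coordGrad e i‖ * t else ‖coordGrad e i‖ * t := by
          rw [hrepr, if_pos rfl, hy0]
          cases u
          · simp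
          · simp only [if_true]
            ring
        refine ⟨fun j => ?_, (hdep _).2 hi⟩
        by_cases hj : j = i
        · change e.repr (v + y - b) j ∈ _
          rw [hj, hi]
          cases u
          · simp only [Bool.false_eq_true, if_false]
            exact ⟨htg.le, htg1.le⟩
          · simp only [if_true]
            constructor <;> linarith
        · change e.repr (v + y - b) j ∈ _
          rw [hrepr, if_neg hj, add_zero]
          exact hy j
    rw [himg, ENNReal.ofReal_one, one_mul]
    exact (IsometryEquiv.addLeft v).isometry.euclideanHausdorffMeasure_image _

/-- The divergence theorem for the Raviart-Thomas basis function of a facet. -/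
lemma volume_mul_divergence_shape (c : Cell n) (f : c.Facet) (x : Euc n) :
    volume.real c.carrier * divergence (c.shape f) x = (μHE[n - 1] (c.facet f)).toReal := by
  cases c with
  | simplex s =>
    obtain ⟨i, rfl⟩ := exists_opposite_eq f
    have hh := s.height_pos i
    have hn : (n : ℝ) ≠ 0 := Nat.cast_ne_zero.2 (NeZero.ne n)
    rw [divergence_shape_simplex, measureReal_def, volume_simplex s i, ENNReal.toReal_mul,
      ENNReal.toReal_ofReal (by positivity)]
    field_simp
  | box b e =>
    obtain ⟨i, t, rfl⟩ := exists_side_eq f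
    have hg := norm_coordGrad_pos e i
    rw [divergence_shape_box, measureReal_def, volume_box b e i t, ENNReal.toReal_mul,
      ENNReal.toReal_ofReal (by positivity)]
    field_simp

lemma divergence_shape_pos (c : Cell n) (f : c.Facet) (x : Euc n) :
    0 < divergence (c.shape f) x := by
  cases c with
  | simplex s =>
    obtain ⟨i, rfl⟩ := exists_opposite_eq f
    rw [divergence_shape_simplex]
    exact mul_pos (Nat.cast_pos.2 (NeZero.pos n)) (inv_pos.2 (s.height_pos i))
  | box b e =>
    obtain ⟨i, t, rfl⟩ := exists_side_eq f
    rw [divergence_shape_box]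
    exact norm_coordGrad_pos e i

lemma volume_real_carrier_pos (c : Cell n) : 0 < volume.real c.carrier :=
  ENNReal.toReal_pos c.volume_carrier_pos.ne' c.volume_carrier_lt_top.ne

/-- Positivity of `toReal` includes finiteness of the facet measure. Both follow from the divergence
identity, whose left side is positive. -/
lemma facet_measure_pos (c : Cell n) (f : c.Facet) : 0 < (μHE[n - 1] (c.facet f)).toReal := by
  rw [← c.volume_mul_divergence_shape f 0]
  exact mul_pos c.volume_real_carrier_pos (c.divergence_shape_pos f 0)

end Cell

/-! ### Faces of cells and shared facets -/

/-- The part of `b` orthogonal to `a` is by hypothesis orthogonal to `b`, hence zero; unit length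
leaves only the sign. -/
lemma eq_or_eq_neg_of_orthogonal {E : Type*} [NormedAddCommGroup E] [InnerProductSpace ℝ E]
    {a b : E} (ha : inner ℝ a a = (1 : ℝ)) (hb : inner ℝ b b = (1 : ℝ))
    (h : ∀ v : E, inner ℝ v a = (0 : ℝ) → inner ℝ v b = (0 : ℝ)) : b = a ∨ b = -a := by
  have hl : inner ℝ (b - inner ℝ b a • a) b = (0 : ℝ) := h _ (by
    rw [inner_sub_left, real_inner_smul_left, ha, mul_one, sub_self])
  rw [inner_sub_left, real_inner_smul_left, hb, real_inner_comm b a] at hl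
  have hbl : b = inner ℝ b a • a := by
    rw [← sub_eq_zero, ← inner_self_eq_zero (𝕜 := ℝ)]
    simp only [inner_sub_left, inner_sub_right, real_inner_smul_left, real_inner_smul_right, ha, hb,
      real_inner_comm b a]
    linarith
  have : (inner ℝ b a - 1) * (inner ℝ b a + 1) = (0 : ℝ) := by linarith
  rcases mul_eq_zero.1 this with h1 | h1
  · left
    rw [hbl, sub_eq_zero.1 h1, one_smul]
  · right
    rw [hbl, eq_neg_of_add_eq_zero_left h1, neg_one_smul]

namespace Cell

variable {n : ℕ} [NeZero n]

lemma eventually_depth_pos (c : Cell n) (x v : Euc n) :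
    ∀ᶠ r in nhds (0 : ℝ), ∀ f, 0 < c.depth f x → 0 < c.depth f (x + r • v) := by
  refine Filter.eventually_all.2 fun f => ?_
  by_cases h : 0 < c.depth f x
  · have hc : ContinuousAt (fun r : ℝ => c.depth f (x + r • v)) 0 :=
      ((c.continuous_depth f).comp (by fun_prop)).continuousAt
    have h0 : 0 < c.depth f (x + (0 : ℝ) • v) := by simpa using h
    filter_upwards [hc.eventually (lt_mem_nhds h0)] with r hr _ using hr
  · exact Filter.Eventually.of_forall fun r h' => absurd h' h

/-- An extreme subset of a cell that contains `x` contains all points that lie on the same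
facets. -/
lemma mem_of_isExtreme {c : Cell n} {E : Set (Euc n)} (hE : IsExtreme ℝ c.carrier E) {x z : Euc n}
    (hx : x ∈ E) (hz : z ∈ c.carrier) (h : ∀ f, c.depth f x = 0 → c.depth f z = 0) : z ∈ E := by
  have hx' := hE.1 hx
  -- Prolong the segment from `z` to `x` slightly beyond `x`. It stays in the cell: facets through
  -- `x` also contain `z`, so their depths remain zero, and the other depths remain positive. Now
  -- `x` lies strictly between `z` and a point of the cell, and extremeness puts `z` in `E`.
  obtain ⟨r, hr, hr0⟩ := (((c.eventually_depth_pos x (x - z)).filter_mono nhdsWithin_le_nhds).and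
    (self_mem_nhdsWithin : Set.Ioi (0 : ℝ) ∈ nhdsWithin 0 (Set.Ioi 0))).exists
  have hr0 : 0 < r := hr0
  have hy : x + r • (x - z) ∈ c.carrier := by
    refine (c.mem_carrier_iff _).2 fun f => ?_
    rcases (((c.mem_carrier_iff _).1 hx') f).eq_or_lt with h0 | h0
    · have h1 := h f h0.symm
      have : x + r • (x - z) = (1 + r) • x + (-r) • z := by module
      rw [this, depth_combo _ _ _ _ (by ring), ← h0, h1]
      simp
    · exact (hr f h0).le
  refine hE.2 hz hy hx ⟨r / (1 + r), 1 / (1 + r), by positivity, by positivity,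
    by field_simp; ring, ?_⟩
  have h1 : (1 + r) ≠ 0 := by positivity
  match_scalars <;> field_simp
  ring

lemma eq_carrier_of_isExtreme {c : Cell n} {E : Set (Euc n)} (hE : IsExtreme ℝ c.carrier E)
    {x : Euc n} (hx : x ∈ E) (hxi : x ∈ interior c.carrier) : E = c.carrier :=
  hE.1.antisymm fun _ hz => mem_of_isExtreme hE hx hz
    fun f hf => absurd hf ((c.mem_interior_iff x).1 hxi f).ne'

/-- Depths are affine and nonnegative on the cell, so a midpoint has positive depth wherever one of
its end points does. -/
lemma exists_mem_forall_depth_pos {c : Cell n} {E : Set (Euc n)} (hEc : E ⊆ c.carrier)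
    (hconv : Convex ℝ E) (hne : E.Nonempty) (S : Finset c.Facet)
    (hS : ∀ f ∈ S, ∃ y ∈ E, 0 < c.depth f y) : ∃ x ∈ E, ∀ f ∈ S, 0 < c.depth f x := by
  induction S using Finset.induction_on with
  | empty => exact ⟨hne.some, hne.some_mem, by simp⟩
  | insert g S _ ih =>
    obtain ⟨x, hx, hxS⟩ := ih fun f hf => hS f (Finset.mem_insert_of_mem hf)
    obtain ⟨y, hy, hyg⟩ := hS g (Finset.mem_insert_self _ _)
    refine ⟨(2⁻¹ : ℝ) • x + (2⁻¹ : ℝ) • y, hconv hx hy (by norm_num) (by norm_num) (by norm_num),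
      fun f hf => ?_⟩
    have hx0 := (c.mem_carrier_iff x).1 (hEc hx) f
    have hy0 := (c.mem_carrier_iff y).1 (hEc hy) f
    rw [depth_combo _ _ _ _ (by norm_num)]
    rcases Finset.mem_insert.1 hf with rfl | hf
    · linarith
    · have := hxS f hf
      linarith

/-- A face of a cell that has a point on at most one facet is the cell or a facet. -/
lemma eq_carrier_or_eq_facet {c : Cell n} {E : Set (Euc n)} (hE : IsExtreme ℝ c.carrier E)
    (hconv : Convex ℝ E) {w : Euc n} (hw : w ∈ E)
    (hwf : ∀ f g, f ≠ g → c.depth f w = 0 → c.depth g w ≠ 0) :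
    E = c.carrier ∨ ∃ f, E = c.facet f := by
  -- If no facet contains `E`, averaging gives a point of `E` interior to the cell, so `E` is the
  -- cell. Otherwise `E` lies in some facet `f`, and `w` lies on no other facet, so `E` contains all
  -- of `f`.
  by_cases h : ∀ f, ∃ y ∈ E, 0 < c.depth f y
  · obtain ⟨x, hx, hxS⟩ := exists_mem_forall_depth_pos hE.1 hconv ⟨w, hw⟩ Finset.univ
      fun f _ => h f
    exact Or.inl (eq_carrier_of_isExtreme hE hx
      ((c.mem_interior_iff x).2 fun f => hxS f (Finset.mem_univ f)))
  · push Not at h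
    obtain ⟨f, hf⟩ := h
    have hf0 : ∀ y ∈ E, c.depth f y = 0 := fun y hy =>
      le_antisymm (hf y hy) ((c.mem_carrier_iff y).1 (hE.1 hy) f)
    refine Or.inr ⟨f, Set.Subset.antisymm
      (fun y hy => (c.mem_facet_iff f y).2 ⟨hE.1 hy, hf0 y hy⟩) fun z hz => ?_⟩
    obtain ⟨hz, hz0⟩ := (c.mem_facet_iff f z).1 hz
    refine mem_of_isExtreme hE hw hz fun g hg => ?_
    by_cases hgf : g = f
    · rw [hgf, hz0]
    · exact absurd (hf0 w hw) (hwf g f hgf hg)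

lemma mem_closure_interior (c : Cell n) {x : Euc n} (hx : x ∈ c.carrier) :
    x ∈ closure (interior c.carrier) := by
  rw [c.convex_carrier.closure_interior_eq_closure_of_nonempty_interior ⟨_, c.center_mem_interior⟩]
  exact subset_closure hx

end Cell

namespace Mesh

/-! ### Disjoint cell interiors and shared facets. -/

variable {n : ℕ} {ι : Type*} {Ω : Set (Euc n)}

lemma isOpen_domain (M : Mesh ι Ω) : IsOpen Ω :=
  M.interior_union ▸ isOpen_interior

variable (M : Mesh ι Ω)

lemma interior_cell_subset (τ : ι) : interior (M.cell τ).carrier ⊆ Ω :=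
  (interior_mono (Set.subset_iUnion (fun τ => (M.cell τ).carrier) τ)).trans M.interior_union.le

lemma domain_subset : Ω ⊆ ⋃ τ, (M.cell τ).carrier :=
  M.interior_union.ge.trans interior_subset

variable [NeZero n]

/-- If cell `τ` lay in cell `σ`, their intersection would be an extreme subset of `σ` meeting its
interior, hence all of `σ`, and the cells would coincide. -/
lemma inter_ne_carrier {τ σ : ι} (h : τ ≠ σ) :
    (M.cell τ).carrier ∩ (M.cell σ).carrier ≠ (M.cell τ).carrier := by
  intro he
  have hsub : (M.cell τ).carrier ⊆ (M.cell σ).carrier := Set.inter_eq_left.1 he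
  have hc := (M.cell τ).center_mem_interior
  have := Cell.eq_carrier_of_isExtreme (M.conforming σ τ)
    ⟨hsub (interior_subset hc), interior_subset hc⟩ (interior_mono hsub hc)
  exact h (M.cell_injective (hsub.antisymm (Set.inter_eq_left.1 this)))

lemma disjoint_interior {τ σ : ι} (h : τ ≠ σ) :
    Disjoint (interior (M.cell τ).carrier) (interior (M.cell σ).carrier) := by
  refine Set.disjoint_left.2 fun x hx hx' => M.inter_ne_carrier h ?_
  exact Cell.eq_carrier_of_isExtreme (M.conforming τ σ)
    ⟨interior_subset hx, interior_subset hx'⟩ hx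

section SharedFacet

variable {M} {τ σ : ι} {f : (M.cell τ).Facet} {g : (M.cell σ).Facet}

/-- A point in the relative interior of a facet that two cells share. -/
lemma exists_mem_relative_interior (hfg : (M.cell τ).facet f = (M.cell σ).facet g) :
    ∃ x, (M.cell τ).depth f x = 0 ∧ (M.cell σ).depth g x = 0 ∧ x ∈ (M.cell τ).facet f ∧
      (∀ f', f' ≠ f → 0 < (M.cell τ).depth f' x) ∧
      ∀ g', g' ≠ g → 0 < (M.cell σ).depth g' x := by
  have h1 := (M.cell τ).facetCenter_mem_facet f
  have h2 := (M.cell σ).facetCenter_mem_facet g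
  have h1' := h1
  have h2' := h2
  rw [hfg] at h1'
  rw [← hfg] at h2'
  rw [Cell.mem_facet_iff, Cell.mem_carrier_iff] at h1 h2 h1' h2'
  -- The midpoint of the two facet centers works without comparing them: each center has positive
  -- depth for the other facets of its own cell, and nonnegative depths in the other cell.
  have hh : (2⁻¹ : ℝ) + 2⁻¹ = 1 := by norm_num
  have hd : (M.cell τ).depth f
      ((2⁻¹ : ℝ) • (M.cell τ).facetCenter f + (2⁻¹ : ℝ) • (M.cell σ).facetCenter g) = 0 := by
    rw [Cell.depth_combo _ _ _ _ hh, h1.2, h2'.2]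
    simp
  refine ⟨(2⁻¹ : ℝ) • (M.cell τ).facetCenter f + (2⁻¹ : ℝ) • (M.cell σ).facetCenter g,
    hd, ?_, ?_, ?_, ?_⟩
  · rw [Cell.depth_combo _ _ _ _ hh, h1'.2, h2.2]
    simp
  · refine (Cell.mem_facet_iff _ _ _).2 ⟨(Cell.mem_carrier_iff _ _).2 fun f' => ?_, hd⟩
    rw [Cell.depth_combo _ _ _ _ hh]
    have := h1.1 f'
    have := h2'.1 f'
    linarith
  · intro f' hf'
    rw [Cell.depth_combo _ _ _ _ hh]
    have := (M.cell τ).depth_facetCenter_pos hf'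
    have := h2'.1 f'
    linarith
  · intro g' hg'
    rw [Cell.depth_combo _ _ _ _ hh]
    have := (M.cell σ).depth_facetCenter_pos hg'
    have := h1'.1 g'
    linarith

/-- The outward normals of two cells on a shared facet are opposite. -/
lemma normal_eq_neg_of_shared (h : τ ≠ σ) (hfg : (M.cell τ).facet f = (M.cell σ).facet g) :
    (M.cell σ).normal g = -(M.cell τ).normal f := by
  obtain ⟨x, hxf, hxg, -, hx1, hx2⟩ := exists_mem_relative_interior hfg
  set a := (M.cell τ).normal f
  set b := (M.cell σ).normal g
  have ha : inner ℝ a a = 1 := by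
    rw [real_inner_self_eq_norm_sq, Cell.norm_normal, one_pow]
  have hb : inner ℝ b b = 1 := by
    rw [real_inner_self_eq_norm_sq, Cell.norm_normal, one_pow]
  -- From `x` a small step in any direction keeps the depths of all facets other than `f` and `g`
  -- positive.
  have hpos : ∀ v, ∃ r : ℝ, 0 < r ∧ (∀ f', f' ≠ f → 0 < (M.cell τ).depth f' (x + r • v)) ∧
      ∀ g', g' ≠ g → 0 < (M.cell σ).depth g' (x + r • v) := by
    intro v
    obtain ⟨r, ⟨hr, hr'⟩, hr0⟩ := (((((M.cell τ).eventually_depth_pos x v).and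
      ((M.cell σ).eventually_depth_pos x v)).filter_mono nhdsWithin_le_nhds).and
      (self_mem_nhdsWithin : Set.Ioi (0 : ℝ) ∈ nhdsWithin 0 (Set.Ioi 0))).exists
    exact ⟨r, hr0, fun f' hf' => hr f' (hx1 f' hf'), fun g' hg' => hr' g' (hx2 g' hg')⟩
  -- A direction tangent to `f` stays in `f`, which is the same set as `g`, so it is tangent to `g`
  -- too.
  have hperp : ∀ v, inner ℝ v a = 0 → inner ℝ v b = 0 := by
    intro v hv
    obtain ⟨r, hr0, hr, -⟩ := hpos v
    have hd : (M.cell τ).depth f (x + r • v) = 0 := by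
      rw [Cell.depth_add, hxf, real_inner_smul_left, hv]
      simp
    have hmem : x + r • v ∈ (M.cell τ).facet f := by
      refine (Cell.mem_facet_iff _ _ _).2 ⟨(Cell.mem_carrier_iff _ _).2 fun f' => ?_, hd⟩
      by_cases hf' : f' = f
      · rw [hf', hd]
      · exact (hr f' hf').le
    rw [hfg, Cell.mem_facet_iff, Cell.depth_add, hxg, real_inner_smul_left, zero_sub, neg_eq_zero,
      mul_eq_zero_iff_left hr0.ne'] at hmem
    exact hmem.2
  rcases eq_or_eq_neg_of_orthogonal ha hb hperp with hab | hab
  -- Equal outward normals would place a point near `x` in the interior of both cells.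
  · exfalso
    obtain ⟨r, hr0, hr, hr'⟩ := hpos (-a)
    have hdisj := Set.disjoint_left.1 (M.disjoint_interior h)
    refine @hdisj (x + r • -a) ((Cell.mem_interior_iff _ _).2 fun f' => ?_)
      ((Cell.mem_interior_iff _ _).2 fun g' => ?_)
    · by_cases hf' : f' = f
      · rw [hf', Cell.depth_add, hxf, real_inner_smul_left, inner_neg_left]
        change 0 < 0 - r * -inner ℝ a a
        rw [ha]
        linarith
      · exact hr f' hf'
    · by_cases hg' : g' = g
      · rw [hg', Cell.depth_add, hxg, real_inner_smul_left, inner_neg_left]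
        change 0 < 0 - r * -inner ℝ a b
        rw [hab, ha]
        linarith
      · exact hr' g' hg'
  · exact hab

/-- A shared facet does not lie on the boundary of the domain. -/
lemma not_subset_frontier_of_shared (h : τ ≠ σ)
    (hfg : (M.cell τ).facet f = (M.cell σ).facet g) : ¬ (M.cell τ).facet f ⊆ frontier Ω := by
  obtain ⟨x, hxf, hxg, hx, hx1, hx2⟩ := exists_mem_relative_interior hfg
  have hn := normal_eq_neg_of_shared h hfg
  intro hsub
  -- Near `x` only the depths for `f` and `g` can become negative, and they are opposite to each
  -- other. Each nearby point thus lies in one of the two cells, and `x` is interior to their union.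
  have hxΩ : x ∈ Ω := by
    rw [← M.interior_union, mem_interior_iff_mem_nhds]
    have hU : ∀ᶠ y in nhds x, (∀ f', f' ≠ f → 0 < (M.cell τ).depth f' y) ∧
        ∀ g', g' ≠ g → 0 < (M.cell σ).depth g' y := by
      refine Filter.Eventually.and ?_ ?_
      · refine Filter.eventually_all.2 fun f' => ?_
        by_cases hf' : f' = f
        · simp [hf']
        · filter_upwards [((M.cell τ).continuous_depth f').continuousAt.eventually
            (lt_mem_nhds (hx1 f' hf'))] with y hy _ using hy
      · refine Filter.eventually_all.2 fun g' => ?_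
        by_cases hg' : g' = g
        · simp [hg']
        · filter_upwards [((M.cell σ).continuous_depth g').continuousAt.eventually
            (lt_mem_nhds (hx2 g' hg'))] with y hy _ using hy
    filter_upwards [hU] with y hy
    have hd : (M.cell σ).depth g y = -(M.cell τ).depth f y := by
      have h1 := (M.cell τ).depth_add f x (y - x)
      have h2 := (M.cell σ).depth_add g x (y - x)
      rw [add_sub_cancel] at h1 h2
      rw [h1, h2, hn, hxf, hxg, inner_neg_right]
      ring
    rcases le_total 0 ((M.cell τ).depth f y) with h0 | h0
    · refine Set.mem_iUnion.2 ⟨τ, (Cell.mem_carrier_iff _ _).2 fun f' => ?_⟩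
      by_cases hf' : f' = f
      · rwa [hf']
      · exact (hy.1 f' hf').le
    · refine Set.mem_iUnion.2 ⟨σ, (Cell.mem_carrier_iff _ _).2 fun g' => ?_⟩
      by_cases hg' : g' = g
      · rw [hg', hd]
        linarith
      · exact (hy.2 g' hg').le
  have := hsub hx
  rw [M.isOpen_domain.frontier_eq] at this
  exact this.2 hxΩ

/-- A facet is shared by at most two cells. -/
lemma eq_of_shared {ρ : ι} {k : (M.cell ρ).Facet} (h : τ ≠ σ) (h' : τ ≠ ρ)
    (hfg : (M.cell τ).facet f = (M.cell σ).facet g)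
    (hfk : (M.cell τ).facet f = (M.cell ρ).facet k) : σ = ρ := by
  by_contra hne
  -- Three unit normals cannot be pairwise opposite.
  have h1 := normal_eq_neg_of_shared h hfg
  have h2 := normal_eq_neg_of_shared h' hfk
  have h3 := normal_eq_neg_of_shared hne (hfg.symm.trans hfk)
  rw [h1, h2, neg_neg, neg_eq_iff_add_eq_zero, ← two_smul ℝ,
    smul_eq_zero_iff_right two_ne_zero] at h3
  have := (M.cell τ).norm_normal f
  rw [h3, norm_zero] at this
  exact zero_ne_one this

/-- The Raviart-Thomas basis function of a facet that the cells `τ` and `σ` share. -/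
lemma exists_mem_RTzero_of_shared (h : τ ≠ σ)
    (hfg : (M.cell τ).facet f = (M.cell σ).facet g) :
    ∃ v ∈ M.RTzero, v τ = (M.cell τ).shape f ∧ v σ = -(M.cell σ).shape g ∧
      ∀ ρ, ρ ≠ τ → ρ ≠ σ → v ρ = 0 := by
  -- The minus sign balances the two outward fluxes, `1` from `τ` and `-1` from `σ`, as both are
  -- measured against the outward normal of their own cell.
  let v : ι → Euc n → Euc n :=
    Function.update (Function.update 0 σ (-(M.cell σ).shape g)) τ ((M.cell τ).shape f)
  have hτ : v τ = (M.cell τ).shape f := by simp [v]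
  have hσ : v σ = -(M.cell σ).shape g := by simp [v, h.symm]
  have h0 : ∀ ρ, ρ ≠ τ → ρ ≠ σ → v ρ = 0 := fun ρ h1 h2 => by simp [v, h1, h2]
  have hnτ : ∀ f' x, x ∈ (M.cell τ).facet f' →
      inner ℝ (v τ x) ((M.cell τ).normal f') = if f = f' then 1 else 0 := by
    intro f' x hx
    rw [hτ, Cell.inner_shape_normal _ _ _ ((Cell.mem_facet_iff _ _ _).1 hx).2]
  have hnσ : ∀ g' x, x ∈ (M.cell σ).facet g' →
      inner ℝ (v σ x) ((M.cell σ).normal g') = if g = g' then -1 else 0 := by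
    intro g' x hx
    rw [hσ, Pi.neg_apply, inner_neg_left,
      Cell.inner_shape_normal _ _ _ ((Cell.mem_facet_iff _ _ _).1 hx).2]
    split_ifs <;> simp
  have hself : ∀ ρ, ρ = τ ∨ ρ = σ ∨ ρ ≠ τ ∧ ρ ≠ σ := fun ρ => by tauto
  refine ⟨v, ⟨⟨fun ρ => ?_, ?_⟩, ?_⟩, hτ, hσ, h0⟩
  · rcases hself ρ with rfl | rfl | ⟨h1, h2⟩
    · rw [hτ]
      exact Cell.shape_mem_RT0 _ _
    · rw [hσ]
      exact neg_mem (Cell.shape_mem_RT0 _ _)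
    · rw [h0 ρ h1 h2]
      exact zero_mem _
  -- Between `τ` and `σ` the facets `f` and `g` are matched only with each other. A facet shared
  -- with a third cell is neither of them, by `eq_of_shared`, so both contributions vanish.
  · intro ρ ρ' hne k k' hk x hx
    have hx' : x ∈ (M.cell ρ').facet k' := hk ▸ hx
    rcases hself ρ with rfl | rfl | ⟨h1, h2⟩ <;> rcases hself ρ' with rfl | rfl | ⟨h1', h2'⟩
    · exact absurd rfl hne
    · rw [hnτ k x hx, hnσ k' x hx']
      have : f = k ↔ g = k' := by
        rw [← (M.cell ρ).facet_injective.eq_iff, hfg, hk, (M.cell ρ').facet_injective.eq_iff]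
      simp only [this]
      split_ifs <;> simp
    · rw [hnτ k x hx, h0 ρ' h1' h2', if_neg]
      · simp
      · rintro rfl
        exact h2' (eq_of_shared h hne hfg hk).symm
    · rw [hnσ k x hx, hnτ k' x hx']
      have : f = k' ↔ g = k := by
        rw [← (M.cell ρ').facet_injective.eq_iff, hfg, ← hk, (M.cell ρ).facet_injective.eq_iff]
      simp only [this]
      split_ifs <;> simp
    · exact absurd rfl hne
    · rw [hnσ k x hx, h0 ρ' h1' h2', if_neg]
      · simp
      · rintro rfl
        exact h1' (eq_of_shared h.symm hne hfg.symm hk).symm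
    · rw [hnτ k' x hx', h0 ρ h1 h2, if_neg]
      · simp
      · rintro rfl
        exact h2 (eq_of_shared h hne.symm hfg hk.symm).symm
    · rw [hnσ k' x hx', h0 ρ h1 h2, if_neg]
      · simp
      · rintro rfl
        exact h1 (eq_of_shared h.symm hne.symm hfg.symm hk.symm).symm
    · rw [h0 ρ h1 h2, h0 ρ' h1' h2']
      simp
  · intro ρ k hk x hx
    rcases hself ρ with rfl | rfl | ⟨h1, h2⟩
    · rw [hnτ k x hx, if_neg]
      rintro rfl
      exact not_subset_frontier_of_shared h hfg hk
    · rw [hnσ k x hx, if_neg]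
      rintro rfl
      exact not_subset_frontier_of_shared h.symm hfg.symm hk
    · rw [h0 ρ h1 h2]
      simp

end SharedFacet

end Mesh

/-! ### Connectivity of the mesh through facets -/

lemma volume_affine_eq_zero {n : ℕ} {φ : Euc n → ℝ} {a : Euc n} {r : ℝ}
    (h : ∀ x, φ x = r + inner ℝ x a) {x₀ : Euc n} (hx₀ : φ x₀ ≠ 0) : volume {x | φ x = 0} = 0 := by
  let S : AffineSubspace ℝ (Euc n) :=
    { carrier := {x | φ x = 0}
      smul_vsub_vadd_mem' := by
        intro t p₁ p₂ p₃ h₁ h₂ h₃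
        simp only [Set.mem_ofPred_eq, h, vsub_eq_sub, vadd_eq_add, inner_add_left, inner_sub_left,
          real_inner_smul_left] at *
        linear_combination t * h₁ - t * h₂ + h₃ }
  refine Measure.addHaar_affineSubspace volume S fun hS => hx₀ ?_
  have : x₀ ∈ S := hS ▸ AffineSubspace.mem_top _ _ _
  exact this

/-- Supplies points in general position: a nonempty open set has positive volume and is not covered
by countably many null sets. -/
lemma exists_mem_open_notMem {n : ℕ} {U : Set (Euc n)} (hU : IsOpen U) (hne : U.Nonempty)
    {J : Type*} [Countable J] {N : J → Set (Euc n)} (hN : ∀ j, volume (N j) = 0) :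
    ∃ x ∈ U, ∀ j, x ∉ N j := by
  have h := measure_iUnion_null hN
  have hpos := hU.measure_pos volume hne
  by_contra hcon
  push Not at hcon
  refine hpos.ne' (measure_mono_null (fun x hx => ?_) h)
  exact Set.mem_iUnion.2 (hcon x hx)

namespace Cell

variable {n : ℕ} [NeZero n]

lemma depth_eq (c : Cell n) (f : c.Facet) (x : Euc n) :
    c.depth f x = inner ℝ (c.facetCenter f) (c.normal f) + inner ℝ x (-c.normal f) := by
  rw [depth, inner_sub_left, inner_neg_right, sub_eq_add_neg]

end Cell

/-- A function on the cells of a mesh of a connected domain that takes the same value on cells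
sharing a facet is constant. -/
lemma Mesh.eq_of_eq_on_shared {n : ℕ} [NeZero n] {ι : Type*} [Finite ι] {Ω : Set (Euc n)}
    (M : Mesh ι Ω) (hΩ : IsConnected Ω) {α : Type*} {p : ι → α}
    (hp : ∀ τ σ (f : (M.cell τ).Facet) (g : (M.cell σ).Facet), τ ≠ σ →
      (M.cell τ).facet f = (M.cell σ).facet g → p τ = p σ) (τ σ : ι) : p τ = p σ := by
  by_contra hne
  -- The cells with value `p τ` and the remaining cells form two closed sets covering `Ω`.
  -- Connectedness yields a point `x` of `Ω` in both, but possibly on a face of low dimension, so it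
  -- has to be replaced by a generic point.
  let U : Set ι → Set (Euc n) := fun S => ⋃ ρ ∈ S, (M.cell ρ).carrier
  let S : Set ι := {ρ | p ρ = p τ}
  have hclosed : ∀ S, IsClosed (U S) := fun S =>
    (Set.toFinite S).isClosed_biUnion fun ρ _ => (M.cell ρ).isClosed_carrier
  have hcover : Ω ⊆ U S ∪ U Sᶜ := by
    intro x hx
    obtain ⟨ρ, hρ⟩ := Set.mem_iUnion.1 (M.domain_subset hx)
    by_cases h : ρ ∈ S
    · exact Or.inl (Set.mem_biUnion h hρ)
    · exact Or.inr (Set.mem_biUnion h hρ)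
  have hcenter : ∀ ρ, (M.cell ρ).center ∈ Ω ∩ (M.cell ρ).carrier := fun ρ =>
    ⟨M.interior_cell_subset ρ (M.cell ρ).center_mem_interior,
      interior_subset (M.cell ρ).center_mem_interior⟩
  obtain ⟨x, hxΩ, hxS, hxT⟩ := isPreconnected_closed_iff.1 hΩ.isPreconnected _ _ (hclosed S)
    (hclosed Sᶜ) hcover
    ⟨_, (hcenter τ).1, Set.mem_biUnion (show τ ∈ S from rfl) (hcenter τ).2⟩
    ⟨_, (hcenter σ).1, Set.mem_biUnion (show σ ∈ Sᶜ from fun h => hne h.symm) (hcenter σ).2⟩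
  obtain ⟨τ', hτ', hxτ'⟩ := Set.mem_iUnion₂.1 hxS
  obtain ⟨σ', hσ', hxσ'⟩ := Set.mem_iUnion₂.1 hxT
  obtain ⟨r, hr, hball⟩ := Metric.isOpen_iff.1 M.isOpen_domain x hxΩ
  have hopen : ∀ ρ, x ∈ (M.cell ρ).carrier →
      (Metric.ball x r ∩ interior (M.cell ρ).carrier).Nonempty := fun ρ hρ =>
    mem_closure_iff.1 ((M.cell ρ).mem_closure_interior hρ) _ Metric.isOpen_ball
      (Metric.mem_ball_self hr)
  -- Near `x`, inside a cell of the first kind, choose `y` off the hyperplanes of all facets.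
  obtain ⟨y, ⟨hyb, hyi⟩, hy⟩ := exists_mem_open_notMem
    (Metric.isOpen_ball.inter isOpen_interior) (hopen τ' hxτ')
    (J := Σ ρ, (M.cell ρ).Facet) (N := fun j => {x | (M.cell j.1).depth j.2 x = 0})
    fun j => volume_affine_eq_zero ((M.cell j.1).depth_eq j.2)
      ((M.cell j.1).depth_center_pos j.2).ne'
  have hy : ∀ ρ f, (M.cell ρ).depth f y ≠ 0 := fun ρ f => hy ⟨ρ, f⟩
  -- Near `x`, inside a cell of the second kind, choose `z` such that two depths of one cell never
  -- vanish together on the segment from `y`. This excludes the zeros of a 2×2 determinant, affine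
  -- in `z` and nonzero at the center of `f`.
  obtain ⟨z, ⟨hzb, hzi⟩, hz⟩ := exists_mem_open_notMem
    (Metric.isOpen_ball.inter isOpen_interior) (hopen σ' hxσ')
    (J := Σ ρ, {fg : (M.cell ρ).Facet × (M.cell ρ).Facet // fg.2 ≠ fg.1})
    (N := fun j => {x | (M.cell j.1).depth j.2.1.2 y * (M.cell j.1).depth j.2.1.1 x -
      (M.cell j.1).depth j.2.1.1 y * (M.cell j.1).depth j.2.1.2 x = 0}) (by
      rintro ⟨ρ, ⟨f, g⟩, hfg⟩
      refine volume_affine_eq_zero (x₀ := (M.cell ρ).facetCenter f)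
        (r := (M.cell ρ).depth g y * inner ℝ ((M.cell ρ).facetCenter f) ((M.cell ρ).normal f) -
          (M.cell ρ).depth f y * inner ℝ ((M.cell ρ).facetCenter g) ((M.cell ρ).normal g))
        (a := -((M.cell ρ).depth g y • (M.cell ρ).normal f -
          (M.cell ρ).depth f y • (M.cell ρ).normal g)) (fun x => ?_) ?_
      · simp only [(M.cell ρ).depth_eq f x, (M.cell ρ).depth_eq g x, inner_neg_right,
          inner_sub_right, real_inner_smul_right]
        ring
      · rw [Cell.depth_facetCenter_self, mul_zero, zero_sub, neg_ne_zero]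
        exact mul_ne_zero (hy ρ f) ((M.cell ρ).depth_facetCenter_pos hfg).ne')
  have hz : ∀ ρ (f g : (M.cell ρ).Facet), g ≠ f → (M.cell ρ).depth g y * (M.cell ρ).depth f z -
      (M.cell ρ).depth f y * (M.cell ρ).depth g z ≠ 0 := fun ρ f g h => hz ⟨ρ, ⟨f, g⟩, h⟩
  -- The segment is connected and lies in a ball inside `Ω`, so it again contains a point `w` in
  -- both closed sets.
  have hseg : segment ℝ y z ⊆ Ω := ((convex_ball x r).segment_subset hyb hzb).trans hball
  obtain ⟨w, hw, hwS, hwT⟩ := isPreconnected_closed_iff.1 (convex_segment y z).isPreconnected _ _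
    (hclosed S) (hclosed Sᶜ) (hseg.trans hcover)
    ⟨y, left_mem_segment ℝ y z, Set.mem_biUnion hτ' (interior_subset hyi)⟩
    ⟨z, right_mem_segment ℝ y z, Set.mem_biUnion hσ' (interior_subset hzi)⟩
  obtain ⟨ρ, hρ, hwρ⟩ := Set.mem_iUnion₂.1 hwS
  obtain ⟨ρ', hρ', hwρ'⟩ := Set.mem_iUnion₂.1 hwT
  have hw2 : ∀ ρ (f g : (M.cell ρ).Facet), f ≠ g → (M.cell ρ).depth f w = 0 →
      (M.cell ρ).depth g w ≠ 0 := by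
    intro ρ f g hfg hf hg
    obtain ⟨a, b, -, -, hab, rfl⟩ := hw
    rw [Cell.depth_combo _ _ _ _ hab] at hf hg
    -- Eliminating leaves `b` times the determinant, so two vanishing depths force `w = y`, which
    -- lies on no facet hyperplane.
    have hb : b = 0 := (mul_eq_zero.1 (show b * _ = 0 by
      linear_combination (M.cell ρ).depth g y * hf - (M.cell ρ).depth f y * hg)).resolve_right
        (hz ρ f g hfg.symm)
    have ha : a = 1 := by linarith
    rw [ha, hb] at hf
    exact hy ρ f (by linarith)
  have hρρ' : ρ ≠ ρ' := fun h => hρ' (h ▸ hρ)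
  -- The intersection of the two cells is a face of each through `w`, which lies on at most one
  -- facet of either cell. It is therefore a facet of both.
  obtain ⟨f, hf⟩ := (Cell.eq_carrier_or_eq_facet (M.conforming ρ ρ')
    ((M.cell ρ).convex_carrier.inter (M.cell ρ').convex_carrier) ⟨hwρ, hwρ'⟩
    (hw2 ρ)).resolve_left (M.inter_ne_carrier hρρ')
  obtain ⟨g, hg⟩ := (Cell.eq_carrier_or_eq_facet (M.conforming ρ' ρ)
    ((M.cell ρ').convex_carrier.inter (M.cell ρ).convex_carrier) ⟨hwρ', hwρ⟩
    (hw2 ρ')).resolve_left (M.inter_ne_carrier hρρ'.symm)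
  exact hρ' ((hp ρ ρ' f g hρρ' (by rw [← hf, ← hg, Set.inter_comm])).symm.trans hρ)

/-! ### Terminal nodes of a forest -/

/-- Each tree of a rooted forest has a terminal node. -/
lemma RootedForest.exists_isTerminal_reachable {V : Type*} [Finite V] (F : RootedForest V) (v : V) :
    ∃ t, F.IsTerminal t ∧ F.graph.Reachable v t := by
  cases nonempty_fintype V
  let C := F.graph.connectedComponentMk v
  obtain ⟨d, ⟨hd, hdC⟩, hdu⟩ := F.existsUnique_root C
  obtain ⟨w, hdw, -⟩ := F.root_degree d hd
  have hwC : F.graph.connectedComponentMk w = C := by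
    rw [← hdC]
    exact SimpleGraph.ConnectedComponent.sound hdw.symm.reachable
  -- The tree contains its root and the neighbor of the root, so it has two different leaves, of
  -- which at least one is not the root.
  have : Nontrivial C := ⟨⟨d, hdC⟩, ⟨w, hwC⟩, fun h => hdw.ne (congrArg Subtype.val h)⟩
  obtain ⟨a, b, hab, ha, hb⟩ :=
    (F.acyclic.isTree_connectedComponent C).exists_ne_and_degree_eq_one
  have key : ∀ a : C, C.toSimpleGraph.degree a = 1 → a.1 ≠ d →
      ∃ t, F.IsTerminal t ∧ F.graph.Reachable v t := by
    intro a ha had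
    have haC : F.graph.connectedComponentMk a.1 = C := a.2
    refine ⟨a.1, ⟨fun h => had (hdu _ ⟨h, haC⟩), ?_⟩,
      SimpleGraph.ConnectedComponent.exact haC.symm⟩
    obtain ⟨b, hb, hbu⟩ := SimpleGraph.degree_eq_one_iff_existsUnique_adj.1 ha
    -- All neighbors in the graph stay in the component, so a leaf of the component is a leaf of the
    -- graph.
    refine ⟨b.1, hb, fun y hy => ?_⟩
    have hyC : F.graph.connectedComponentMk y = C := by
      rw [← haC]
      exact SimpleGraph.ConnectedComponent.sound hy.symm.reachable
    exact congrArg Subtype.val (hbu ⟨y, hyC⟩ hy)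
  by_cases had : a.1 = d
  · exact key b hb fun hbd => hab (Subtype.ext (had.trans hbd.symm))
  · exact key a ha had

/-! ### Averaged permeability -/

section Permeability

variable {n : ℕ} {ι V : Type*} {Ω : Set (Euc n)} {F : RootedForest V}

/-- A closed cell need not lie in the open set `Ω`, but its interior does, and the difference is a
null set. -/
lemma Mesh.restrict_carrier_le [NeZero n] (M : Mesh ι Ω) (τ : ι) :
    (volume : Measure (Euc n)).restrict (M.cell τ).carrier ≤ volume.restrict Ω := by
  rw [← Measure.restrict_congr_set
    (interior_ae_eq_of_null_frontier (M.cell τ).volume_frontier_carrier)]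
  exact Measure.restrict_mono (M.interior_cell_subset τ) le_rfl

/-- The quadratic form of the average is the average of the quadratic forms, which are positive
almost everywhere on a set of positive measure. -/
lemma cellPermeability_posDef [NeZero n] [Fintype ι] [Fintype V] (M : Mesh ι Ω)
    (K : Parameters Ω F) (τ : ι) : (cellPermeability M K τ).PosDef := by
  set μ := (volume : Measure (Euc n)).restrict (M.cell τ).carrier with hμ
  have hpd : ∀ᵐ x ∂μ, (K.kD x).PosDef := ae_mono (M.restrict_carrier_le τ) K.kD_posDef
  have hint : ∀ i j, Integrable (fun x => K.kD x i j) μ := fun i j =>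
    Integrable.mono_measure (K.kD_integrable i j) (M.restrict_carrier_le τ)
  have hvol : 0 < (volume.real (M.cell τ).carrier)⁻¹ := inv_pos.2 (M.cell τ).volume_real_carrier_pos
  have hentry : ∀ i j, cellPermeability M K τ i j =
      (volume.real (M.cell τ).carrier)⁻¹ * ∫ x, K.kD x i j ∂μ := by
    intro i j
    rw [cellPermeability, Matrix.of_apply, setAverage_eq, smul_eq_mul]
  refine Matrix.PosDef.of_dotProduct_mulVec_pos ?_ fun {x} hx => ?_
  · ext i j
    rw [Matrix.conjTranspose_apply, star_trivial, hentry, hentry]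
    congr 1
    refine integral_congr_ae ?_
    filter_upwards [hpd] with x hx
    simpa using hx.isHermitian.apply i j
  · have hquad : ∀ A : Matrix (Fin n) (Fin n) ℝ,
        star x ⬝ᵥ A.mulVec x = ∑ i, ∑ j, A i j * (x i * x j) := by
      intro A
      simp only [dotProduct, Matrix.mulVec, Finset.mul_sum, Pi.star_apply, star_trivial]
      refine Finset.sum_congr rfl fun i _ => Finset.sum_congr rfl fun j _ => by ring
    have hint2 : Integrable (fun y => ∑ i, ∑ j, K.kD y i j * (x i * x j)) μ :=
      integrable_finsetSum _ fun i _ => integrable_finsetSum _ fun j _ => (hint i j).mul_const _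
    have heq : ∑ i, ∑ j, cellPermeability M K τ i j * (x i * x j) =
        (volume.real (M.cell τ).carrier)⁻¹ * ∫ y, ∑ i, ∑ j, K.kD y i j * (x i * x j) ∂μ := by
      rw [integral_finsetSum _ fun i _ =>
        integrable_finsetSum _ fun j _ => (hint i j).mul_const _, Finset.mul_sum]
      refine Finset.sum_congr rfl fun i _ => ?_
      rw [integral_finsetSum _ fun j _ => (hint i j).mul_const _, Finset.mul_sum]
      refine Finset.sum_congr rfl fun j _ => ?_
      rw [integral_mul_const, hentry, mul_assoc]
    have hpos : ∀ᵐ y ∂μ, 0 < ∑ i, ∑ j, K.kD y i j * (x i * x j) := by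
      filter_upwards [hpd] with y hy
      rw [← hquad]
      exact hy.dotProduct_mulVec_pos hx
    rw [hquad, heq]
    refine mul_pos hvol (lt_of_le_of_ne (integral_nonneg_of_ae (hpos.mono fun y hy => hy.le))
      fun h0 => ?_)
    have hz := (integral_eq_zero_iff_of_nonneg_ae (hpos.mono fun y hy => hy.le) hint2).1 h0.symm
    have hfalse : ∀ᵐ y ∂μ, False := by
      filter_upwards [hpos, hz] with y h1 h2
      exact h1.ne' h2
    rw [Filter.eventually_false_iff_eq_bot, ae_eq_bot, hμ, Measure.restrict_eq_zero] at hfalse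
    exact (M.cell τ).volume_carrier_pos.ne' hfalse

lemma facetWeight_pos [NeZero n] [Fintype ι] [Fintype V] (M : Mesh ι Ω) (K : Parameters Ω F)
    (τ : ι) (f : (M.cell τ).Facet) : 0 < facetWeight M K τ f := by
  refine mul_pos ?_ (div_pos ((M.cell τ).infDist_center_facet_pos f)
    (mul_pos two_pos ((M.cell τ).facet_measure_pos f)))
  have hne : ((M.cell τ).normal f).ofLp ≠ 0 := by
    intro h
    have h1 := (M.cell τ).norm_normal f
    rw [(WithLp.ofLp_eq_zero 2).1 h, norm_zero] at h1
    exact zero_ne_one h1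
  simpa using (cellPermeability_posDef M K τ).inv.dotProduct_mulVec_pos hne

end Permeability

/-! ### Integrals of piecewise constant functions -/

section Integrals

set_option linter.unusedSectionVars false

variable {n : ℕ} [NeZero n] {ι V : Type*} {Ω : Set (Euc n)} {F : RootedForest V}

lemma Mesh.volume_domain_lt_top [Finite ι] (M : Mesh ι Ω) : volume Ω < ⊤ :=
  (measure_mono M.domain_subset).trans_lt
    (isCompact_iUnion fun τ => (M.cell τ).isCompact_carrier).measure_lt_top

lemma Mesh.ae_mem_interior [Countable ι] (M : Mesh ι Ω) :
    ∀ᵐ x ∂(volume.restrict Ω), ∃ τ, x ∈ interior (M.cell τ).carrier := by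
  have h : ∀ᵐ x ∂(volume : Measure (Euc n)), ∀ τ, x ∉ frontier (M.cell τ).carrier :=
    ae_all_iff.2 fun τ => measure_eq_zero_iff_ae_notMem.1 (M.cell τ).volume_frontier_carrier
  filter_upwards [ae_restrict_of_ae h, ae_restrict_mem M.isOpen_domain.measurableSet] with x hx hxΩ
  obtain ⟨τ, hτ⟩ := Set.mem_iUnion.1 (M.domain_subset hxΩ)
  refine ⟨τ, by_contra fun hi => hx τ ?_⟩
  rw [(M.cell τ).isClosed_carrier.frontier_eq]
  exact ⟨hτ, hi⟩

variable [Fintype ι]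

lemma Mesh.glue_of_mem (M : Mesh ι Ω) (u : ι → Euc n → ℝ) {τ : ι} {x : Euc n}
    (hx : x ∈ interior (M.cell τ).carrier) : M.glue u x = u τ x := by
  rw [Mesh.glue, Finset.sum_eq_single τ, Set.indicator_of_mem hx]
  · intro σ _ hσ
    exact Set.indicator_of_notMem (fun h => Set.disjoint_left.1 (M.disjoint_interior hσ) h hx) _
  · simp

lemma Mesh.pwConst_of_mem (M : Mesh ι Ω) (p : ι → ℝ) {τ : ι} {x : Euc n}
    (hx : x ∈ interior (M.cell τ).carrier) : M.pwConst p x = p τ :=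
  M.glue_of_mem _ hx

lemma Mesh.integral_pwConst_mul (M : Mesh ι Ω) (p : ι → ℝ) {φ : Euc n → ℝ}
    (hφ : IntegrableOn φ Ω) :
    ∫ x in Ω, M.pwConst p x * φ x = ∑ τ, p τ * ∫ x in interior (M.cell τ).carrier, φ x := by
  have h : ∀ x, M.pwConst p x * φ x =
      ∑ τ, (interior (M.cell τ).carrier).indicator (fun y => p τ * φ y) x := by
    intro x
    rw [Mesh.pwConst, Mesh.glue, Finset.sum_mul]
    refine Finset.sum_congr rfl fun τ _ => ?_
    by_cases hx : x ∈ interior (M.cell τ).carrier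
    · rw [Set.indicator_of_mem hx, Set.indicator_of_mem hx]
    · rw [Set.indicator_of_notMem hx, Set.indicator_of_notMem hx, zero_mul]
  simp_rw [h]
  rw [integral_finsetSum _ fun τ _ => (hφ.const_mul (p τ)).indicator isOpen_interior.measurableSet]
  refine Finset.sum_congr rfl fun τ _ => ?_
  rw [setIntegral_indicator isOpen_interior.measurableSet,
    Set.inter_eq_right.2 (M.interior_cell_subset τ), integral_const_mul]

lemma Mesh.integrableOn_glue_const (M : Mesh ι Ω) (p : ι → ℝ) : IntegrableOn (M.pwConst p) Ω := by
  have hfin : IsFiniteMeasure ((volume : Measure (Euc n)).restrict Ω) :=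
    ⟨by simpa using M.volume_domain_lt_top⟩
  exact integrable_finsetSum _ fun τ _ =>
    (integrable_const (p τ)).indicator isOpen_interior.measurableSet

lemma Mesh.memLp_pwConst (M : Mesh ι Ω) (p : ι → ℝ) :
    MemLp (M.pwConst p) 2 (volume.restrict Ω) := by
  have hfin : IsFiniteMeasure ((volume : Measure (Euc n)).restrict Ω) :=
    ⟨by simpa using M.volume_domain_lt_top⟩
  exact memLp_finsetSum _ fun τ _ =>
    (memLp_const (p τ)).indicator isOpen_interior.measurableSet

lemma Mesh.setIntegral_pwConst (M : Mesh ι Ω) (p : ι → ℝ) (τ : ι) :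
    ∫ x in interior (M.cell τ).carrier, M.pwConst p x = volume.real (M.cell τ).carrier * p τ := by
  rw [setIntegral_congr_fun (g := fun _ => p τ) isOpen_interior.measurableSet
    fun x hx => M.pwConst_of_mem p hx, setIntegral_const, smul_eq_mul, measureReal_def,
    (M.cell τ).volume_interior_carrier, measureReal_def]

variable [Fintype V] {M : Mesh ι Ω} {K : Parameters Ω F}

lemma integrableOn_kS (M : Mesh ι Ω) (K : Parameters Ω F) (i : F.Terminal) :
    IntegrableOn (K.kS i) Ω := by
  obtain ⟨C, hC⟩ := K.kS_bounded
  have hfin : IsFiniteMeasure ((volume : Measure (Euc n)).restrict Ω) :=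
    ⟨by simpa using M.volume_domain_lt_top⟩
  refine Integrable.of_bound
    (Real.continuous_sqrt.comp_aestronglyMeasurable (K.kT_measurable i)) C ?_
  filter_upwards [ae_restrict_mem M.isOpen_domain.measurableSet] with x hx
  rw [Parameters.kS, Real.norm_of_nonneg (Real.sqrt_nonneg _)]
  exact hC i x hx

/-- The integral of `k_i^S` over the part of a cell that lies in `B_i`. -/
def transferWeight (M : Mesh ι Ω) (K : Parameters Ω F) (i : F.Terminal) (τ : ι) : ℝ :=
  ∫ x in interior (M.cell τ).carrier ∩ K.B i, K.kS i x

lemma measurableSet_interior_inter (M : Mesh ι Ω) (K : Parameters Ω F) (i : F.Terminal) (τ : ι) :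
    MeasurableSet (interior (M.cell τ).carrier ∩ K.B i) :=
  isOpen_interior.measurableSet.inter (K.B_measurable i)

/-- For `S ⊇ B_i`, integrals against a transfer flux are sums over the cells of `𝓜_i`. -/
lemma Flux.integral_mul_transfer (q : Flux M K) (i : F.Terminal) {S : Set (Euc n)}
    (hBS : K.B i ⊆ S) {φ : Euc n → ℝ} {ψ : LocalCell M K i → Euc n → ℝ}
    (hψ : ∀ τ, IntegrableOn (ψ τ) S)
    (hφψ : ∀ (τ : LocalCell M K i), ∀ x ∈ interior (M.cell τ).carrier ∩ K.B i, φ x = ψ τ x) :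
    IntegrableOn (fun x => φ x * q.transfer i x) S ∧
    ∫ x in S, φ x * q.transfer i x =
      ∑ τ : LocalCell M K i, (∫ x in interior (M.cell τ).carrier ∩ K.B i, ψ τ x) * q.2.1 i τ := by
  have h : (fun x => φ x * q.transfer i x) = fun x => ∑ τ : LocalCell M K i,
      (interior (M.cell τ).carrier ∩ K.B i).indicator (fun y => ψ τ y * q.2.1 i τ) x := by
    funext x
    rw [Flux.transfer, Finset.mul_sum]
    refine Finset.sum_congr rfl fun τ _ => ?_
    by_cases hx : x ∈ interior (M.cell τ).carrier ∩ K.B i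
    · rw [Set.indicator_of_mem hx, Set.indicator_of_mem hx, hφψ τ x hx]
    · rw [Set.indicator_of_notMem hx, Set.indicator_of_notMem hx, mul_zero]
  have hi : ∀ τ : LocalCell M K i, IntegrableOn ((interior (M.cell τ).carrier ∩ K.B i).indicator
      (fun y => ψ τ y * q.2.1 i τ)) S := fun τ =>
    ((hψ τ).mul_const _).indicator (measurableSet_interior_inter M K i τ)
  rw [h]
  refine ⟨integrable_finsetSum _ fun τ _ => hi τ, ?_⟩
  rw [integral_finsetSum _ fun τ _ => hi τ]
  refine Finset.sum_congr rfl fun τ _ => ?_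
  rw [setIntegral_indicator (measurableSet_interior_inter M K i τ),
    Set.inter_eq_right.2 (Set.inter_subset_right.trans hBS), integral_mul_const]

lemma Flux.transfer_of_mem (q : Flux M K) (i : F.Terminal) (τ : LocalCell M K i) {x : Euc n}
    (hx : x ∈ interior (M.cell τ).carrier ∩ K.B i) : q.transfer i x = q.2.1 i τ := by
  rw [Flux.transfer, Finset.sum_eq_single τ, Set.indicator_of_mem hx]
  · intro σ _ hσ
    refine Set.indicator_of_notMem (fun h => ?_) _
    exact Set.disjoint_left.1 (M.disjoint_interior fun e => hσ (Subtype.ext e)) h.1 hx.1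
  · simp

/-! ### Explicit form of the bilinear forms -/

/-- The measure of the part of a cell that lies in `B_i`. -/
def localVolume (M : Mesh ι Ω) (K : Parameters Ω F) (i : F.Terminal) (τ : ι) : ℝ :=
  volume.real (interior (M.cell τ).carrier ∩ K.B i)

lemma localVolume_pos (i : F.Terminal) (τ : LocalCell M K i) : 0 < localVolume M K i τ := by
  refine ENNReal.toReal_pos ?_ ?_
  · have := τ.2
    rw [← measure_congr ((interior_ae_eq_of_null_frontier
      (M.cell τ).volume_frontier_carrier).inter (Filter.EventuallyEq.refl _ (K.B i)))] at this
    exact this.ne'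
  · exact ((measure_mono (Set.inter_subset_left.trans interior_subset)).trans_lt
      (M.cell τ).volume_carrier_lt_top).ne

/-- The form is diagonal in the coefficients, which makes its bilinearity and definiteness plain
algebra on finite sums. -/
lemma lumpedInner_eq (q v : Flux M K) : lumpedInner q v =
    (∑ τ, ∑ f, facetWeight M K τ f * q.normalComp τ f * v.normalComp τ f) +
    (∑ i, ∑ τ : LocalCell M K i, localVolume M K i τ * q.2.1 i τ * v.2.1 i τ) +
    2⁻¹ * ∑ i, ∑ j, (K.kN s(i, j))⁻¹ * q.2.2.1 i j * v.2.2.1 i j := by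
  rw [lumpedInner]
  congr 2
  refine Finset.sum_congr rfl fun i _ => ?_
  have hfin : volume (K.B i) ≠ ⊤ :=
    ((measure_mono (K.B_subset i)).trans_lt M.volume_domain_lt_top).ne
  rw [(v.integral_mul_transfer i subset_rfl (φ := q.transfer i)
    (ψ := fun τ _ => q.2.1 i τ) (fun τ => integrableOn_const hfin)
    fun τ x hx => q.transfer_of_mem i τ hx).2]
  refine Finset.sum_congr rfl fun τ _ => ?_
  rw [setIntegral_const, smul_eq_mul, localVolume]

/-- All integrals become finite sums because the integrands are piecewise constant or `k_i^S` times
such a function. The divergence is constant for each local field, so it may be evaluated at the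
origin, even outside the cell. -/
lemma l2Inner_mdDiv_eq (p : Pressure ι F) (v : Flux M K) :
    l2Inner Ω (M.toMDFun p) v.mdDiv =
      (∑ τ, p.1 τ * (volume.real (M.cell τ).carrier * divergence (v.1.1 τ) 0)) -
      (∑ i, ∑ τ : LocalCell M K i, p.1 τ * transferWeight M K i τ * v.2.1 i τ) +
      ∑ i : F.Free, p.2 i * ((if h : F.IsTerminal i.1 then
        ∑ τ : LocalCell M K ⟨i.1, h⟩, transferWeight M K ⟨i.1, h⟩ τ * v.2.1 ⟨i.1, h⟩ τ else 0) -
        ∑ j, v.2.2.1 j i.1) := by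
  have hglue : M.glue (fun τ => divergence (v.1.1 τ)) =
      M.pwConst fun τ => divergence (v.1.1 τ) 0 := by
    have : (fun τ => divergence (v.1.1 τ)) = fun τ _ => divergence (v.1.1 τ) 0 := by
      funext τ x
      exact Cell.divergence_eq_const (v.1.2.1.1 τ) x
    rw [Mesh.pwConst, this]
  have hkS : ∀ i (p : ι → ℝ), IntegrableOn (fun x => M.pwConst p x * K.kS i x * v.transfer i x) Ω ∧
      ∫ x in Ω, M.pwConst p x * K.kS i x * v.transfer i x =
        ∑ τ : LocalCell M K i, p τ * transferWeight M K i τ * v.2.1 i τ := by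
    intro i p
    have h := v.integral_mul_transfer i (K.B_subset i) (φ := fun x => M.pwConst p x * K.kS i x)
      (ψ := fun τ x => p τ * K.kS i x) (fun τ => (integrableOn_kS M K i).const_mul _)
      (fun τ x hx => by rw [M.pwConst_of_mem p hx.1])
    refine ⟨h.1, h.2.trans (Finset.sum_congr rfl fun τ _ => ?_)⟩
    rw [integral_const_mul, transferWeight]
  have hint1 : IntegrableOn (fun x => M.pwConst p.1 x *
      M.pwConst (fun τ => divergence (v.1.1 τ) 0) x) Ω :=
    (M.memLp_pwConst p.1).integrable_mul (M.memLp_pwConst _)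
  rw [l2Inner]
  congr 1
  · simp only [Mesh.toMDFun, Flux.mdDiv, hglue, mul_sub, Finset.mul_sum, ← mul_assoc]
    rw [integral_sub hint1 (integrable_finsetSum _ fun i _ => (hkS i p.1).1),
      integral_finsetSum _ fun i _ => (hkS i p.1).1,
      M.integral_pwConst_mul _ (M.integrableOn_glue_const _)]
    congr 1
    · refine Finset.sum_congr rfl fun τ _ => ?_
      rw [M.setIntegral_pwConst, mul_assoc]
    · exact Finset.sum_congr rfl fun i _ => (hkS i p.1).2
  · refine Finset.sum_congr rfl fun i _ => ?_
    simp only [Mesh.toMDFun, Flux.mdDiv]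
    congr 2
    refine dite_congr rfl (fun h => ?_) fun _ => rfl
    exact (v.integral_mul_transfer ⟨i.1, h⟩ subset_rfl (φ := K.kS ⟨i.1, h⟩)
      (ψ := fun _ => K.kS ⟨i.1, h⟩)
      (fun τ => (integrableOn_kS M K _).mono_set (K.B_subset _)) fun τ x _ => rfl).2

lemma l2Inner_toMDFun_eq (r : MDFun n F) (hr : MemLp r.1 2 (volume.restrict Ω))
    (w : Pressure ι F) : l2Inner Ω r (M.toMDFun w) =
      (∑ τ, w.1 τ * ∫ x in interior (M.cell τ).carrier, r.1 x) + ∑ i, w.2 i * r.2 i := by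
  have hfin : IsFiniteMeasure ((volume : Measure (Euc n)).restrict Ω) :=
    ⟨by simpa using M.volume_domain_lt_top⟩
  rw [l2Inner]
  congr 1
  · simp only [Mesh.toMDFun, mul_comm (r.1 _)]
    exact M.integral_pwConst_mul _ (hr.integrable (by norm_num))
  · exact Finset.sum_congr rfl fun i _ => mul_comm _ _

/-- Some cell that meets `B_i` has positive transfer weight. -/
lemma exists_transferWeight_ne_zero (M : Mesh ι Ω) (K : Parameters Ω F) (i : F.Terminal) :
    ∃ τ : LocalCell M K i, transferWeight M K i τ ≠ 0 := by
  by_contra! hcon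
  obtain ⟨c, hc, hci⟩ := K.kS_integral
  -- Cell interiors cover `Ω` up to a null set, so the weights sum to the integral of `k_i^S`, which
  -- is bounded below by `c > 0`.
  have hsum : ∫ x in K.B i, K.kS i x = ∑ τ, transferWeight M K i τ := by
    have h0 : ∀ x ∉ K.B i, K.kS i x = 0 := fun x hx => by
      rw [Parameters.kS, K.kT_eq_zero i x hx, Real.sqrt_zero]
    have h1 : ∫ x in Ω, M.pwConst 1 x * K.kS i x = ∫ x in Ω, K.kS i x := by
      refine integral_congr_ae ?_
      filter_upwards [M.ae_mem_interior] with x ⟨τ, hx⟩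
      rw [M.pwConst_of_mem _ hx, Pi.one_apply, one_mul]
    rw [← setIntegral_eq_of_subset_of_forall_sdiff_eq_zero M.isOpen_domain.measurableSet
      (K.B_subset i) fun x hx => h0 x hx.2, ← h1, M.integral_pwConst_mul _ (integrableOn_kS M K i)]
    refine Finset.sum_congr rfl fun τ _ => ?_
    rw [Pi.one_apply, one_mul, transferWeight]
    exact setIntegral_eq_of_subset_of_forall_sdiff_eq_zero isOpen_interior.measurableSet
      Set.inter_subset_left fun x hx => h0 x fun hB => hx.2 ⟨hx.1, hB⟩
  have hz : ∑ τ, transferWeight M K i τ = 0 := by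
    refine Finset.sum_eq_zero fun τ _ => ?_
    by_cases hτ : 0 < volume ((M.cell τ).carrier ∩ K.B i)
    · exact hcon ⟨τ, hτ⟩
    · refine setIntegral_measure_zero _ (measure_mono_null ?_ (le_zero_iff.1 (not_lt.1 hτ)))
      exact Set.inter_subset_inter_left _ interior_subset
  have := hci i
  change c ≤ ∫ x in K.B i, K.kS i x at this
  rw [hsum, hz] at this
  exact absurd this (not_le.2 hc)

end Integrals

/-! ### Positive definite forms on finite-dimensional spaces -/

section LinearAlgebra

/-- Positivity makes the map into the dual space injective, and both spaces have the same finite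
dimension. -/
lemma bijective_of_pos {E : Type*} [AddCommGroup E] [Module ℝ E] [FiniteDimensional ℝ E]
    (B : E →ₗ[ℝ] E →ₗ[ℝ] ℝ) (hB : ∀ x, x ≠ 0 → 0 < B x x) : Function.Bijective B := by
  have hinj : Function.Injective B := by
    refine (injective_iff_map_eq_zero B).2 fun x hx => by_contra fun h => ?_
    have := hB x h
    rw [hx, LinearMap.zero_apply] at this
    exact lt_irrefl _ this
  exact ⟨hinj, (LinearMap.injective_iff_surjective_of_finrank_eq_finrank
    (Subspace.dual_finrank_eq (K := ℝ) (V := E)).symm).1 hinj⟩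

/-- The quotient of the two quadratic forms is invariant under scaling and is continuous, hence
bounded, on the compact unit sphere. -/
lemma exists_forall_le_mul {E : Type*} [NormedAddCommGroup E] [NormedSpace ℝ E]
    [FiniteDimensional ℝ E] (B S : E →ₗ[ℝ] E →ₗ[ℝ] ℝ) (hB : ∀ x, x ≠ 0 → 0 < B x x) :
    ∃ C, 0 < C ∧ ∀ x, S x x ≤ C * B x x := by
  have hcont : ∀ T : E →ₗ[ℝ] E →ₗ[ℝ] ℝ, Continuous fun x => T x x := fun T =>
    (LinearMap.toContinuousLinearMap
      ((LinearMap.toContinuousLinearMap : (E →ₗ[ℝ] ℝ) ≃ₗ[ℝ] (E →L[ℝ] ℝ)).toLinearMap ∘ₗ T)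
      ).continuous.clm_apply continuous_id
  have hsphere : ∀ x ∈ Metric.sphere (0 : E) 1, x ≠ 0 := fun x hx h => by simp [h] at hx
  have hq : ContinuousOn (fun x => S x x / B x x) (Metric.sphere (0 : E) 1) :=
    (hcont S).continuousOn.div (hcont B).continuousOn fun x hx => (hB x (hsphere x hx)).ne'
  obtain ⟨C, hC⟩ := (isCompact_sphere (0 : E) 1).bddAbove_image hq
  refine ⟨max C 1, by positivity, fun x => ?_⟩
  by_cases hx : x = 0
  · simp [hx]
  have hn : 0 < ‖x‖ := norm_pos_iff.2 hx
  have hy : ‖x‖⁻¹ • x ∈ Metric.sphere (0 : E) 1 := by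
    simp [norm_smul, hn.ne']
  have h1 := hC ⟨_, hy, rfl⟩
  simp only [map_smul, LinearMap.smul_apply, smul_eq_mul] at h1
  have hb := hB x hx
  rw [mul_div_mul_left _ _ (inv_ne_zero hn.ne'), mul_div_mul_left _ _ (inv_ne_zero hn.ne'),
    div_le_iff₀ hb] at h1
  exact h1.trans (mul_le_mul_of_nonneg_right (le_max_left _ _) hb.le)

end LinearAlgebra

/-! ### The forms of the scheme as bilinear maps -/

section Forms

set_option linter.unusedSectionVars false

variable {n : ℕ} [NeZero n] {ι V : Type*} [Fintype ι] [Fintype V] {Ω : Set (Euc n)}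
  {F : RootedForest V} {M : Mesh ι Ω} {K : Parameters Ω F}

lemma Flux.normalComp_add (q v : Flux M K) (τ : ι) (f : (M.cell τ).Facet) :
    (q + v).normalComp τ f = q.normalComp τ f + v.normalComp τ f :=
  inner_add_left _ _ _

lemma Flux.normalComp_smul (r : ℝ) (q : Flux M K) (τ : ι) (f : (M.cell τ).Facet) :
    (r • q).normalComp τ f = r * q.normalComp τ f :=
  real_inner_smul_left _ _ _

lemma Flux.transfer_coeff_add (q v : Flux M K) (i : F.Terminal) (τ : LocalCell M K i) :
    (q + v).2.1 i τ = q.2.1 i τ + v.2.1 i τ := rfl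

lemma Flux.transfer_coeff_smul (r : ℝ) (q : Flux M K) (i : F.Terminal) (τ : LocalCell M K i) :
    (r • q).2.1 i τ = r * q.2.1 i τ := rfl

lemma Flux.edge_add (q v : Flux M K) (i j : V) :
    (q + v).2.2.1 i j = q.2.2.1 i j + v.2.2.1 i j := rfl

lemma Flux.edge_smul (r : ℝ) (q : Flux M K) (i j : V) :
    (r • q).2.2.1 i j = r * q.2.2.1 i j := rfl

lemma Flux.divergence_add (q v : Flux M K) (τ : ι) :
    divergence ((q + v).1.1 τ) 0 = divergence (q.1.1 τ) 0 + divergence (v.1.1 τ) 0 :=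
  Cell.divergence_add (q.1.2.1.1 τ) (v.1.2.1.1 τ) 0

lemma Flux.divergence_smul (r : ℝ) (q : Flux M K) (τ : ι) :
    divergence ((r • q).1.1 τ) 0 = r * divergence (q.1.1 τ) 0 :=
  Cell.divergence_smul (q.1.2.1.1 τ) r 0

lemma lumpedInner_comm (q v : Flux M K) : lumpedInner q v = lumpedInner v q := by
  simp only [lumpedInner, mul_right_comm _ (Flux.normalComp q _ _), mul_comm (q.transfer _ _),
    mul_right_comm _ (q.2.2.1 _ _)]

lemma lumpedInner_add_left (q q' v : Flux M K) :
    lumpedInner (q + q') v = lumpedInner q v + lumpedInner q' v := by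
  simp only [lumpedInner_eq, Flux.normalComp_add, Flux.transfer_coeff_add, Flux.edge_add, mul_add,
    add_mul, Finset.sum_add_distrib]
  ring

lemma lumpedInner_smul_left (r : ℝ) (q v : Flux M K) :
    lumpedInner (r • q) v = r * lumpedInner q v := by
  simp only [lumpedInner_eq, Flux.normalComp_smul, Flux.transfer_coeff_smul, Flux.edge_smul,
    mul_left_comm _ r, mul_assoc, ← Finset.mul_sum, ← mul_add]

/-- The mass-lumped inner product as a bilinear form. -/
def lumpedForm (M : Mesh ι Ω) (K : Parameters Ω F) : Flux M K →ₗ[ℝ] Flux M K →ₗ[ℝ] ℝ :=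
  LinearMap.mk₂ ℝ lumpedInner lumpedInner_add_left lumpedInner_smul_left
    (fun q v v' => by
      rw [lumpedInner_comm, lumpedInner_add_left, lumpedInner_comm v, lumpedInner_comm v'])
    (fun r q v => by rw [lumpedInner_comm, lumpedInner_smul_left, lumpedInner_comm v, smul_eq_mul])

@[simp] lemma lumpedForm_apply (q v : Flux M K) : lumpedForm M K q v = lumpedInner q v := rfl

lemma lumpedInner_self_nonneg_and (q : Flux M K) :
    0 ≤ lumpedInner q q ∧ (lumpedInner q q = 0 → q = 0) := by
  -- The sign of `kN` is known on edges only; elsewhere the flux vanishes.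
  have hk : ∀ i j, 0 ≤ (K.kN s(i, j))⁻¹ * q.2.2.1 i j * q.2.2.1 i j := by
    intro i j
    by_cases h : F.graph.Adj i j
    · rw [mul_assoc]
      exact mul_nonneg (inv_pos.2 (K.kN_pos _ h)).le (mul_self_nonneg _)
    · rw [q.2.2.2.2 i j h, mul_zero]
  have hw : ∀ τ f, 0 ≤ facetWeight M K τ f * q.normalComp τ f * q.normalComp τ f := fun τ f => by
    rw [mul_assoc]
    exact mul_nonneg (facetWeight_pos M K τ f).le (mul_self_nonneg _)
  have hl : ∀ i (τ : LocalCell M K i), 0 ≤ localVolume M K i τ * q.2.1 i τ * q.2.1 i τ :=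
    fun i τ => by
      rw [mul_assoc]
      exact mul_nonneg (localVolume_pos i τ).le (mul_self_nonneg _)
  have h1 := Finset.sum_nonneg fun τ (_ : τ ∈ Finset.univ) =>
    Finset.sum_nonneg fun f (_ : f ∈ Finset.univ) => hw τ f
  have h2 := Finset.sum_nonneg fun i (_ : i ∈ Finset.univ) =>
    Finset.sum_nonneg fun τ (_ : τ ∈ Finset.univ) => hl i τ
  have h3 := Finset.sum_nonneg fun i (_ : i ∈ Finset.univ) =>
    Finset.sum_nonneg fun j (_ : j ∈ Finset.univ) => hk i j
  rw [lumpedInner_eq]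
  refine ⟨by linarith, fun h0 => ?_⟩
  have e1 : ∑ τ, ∑ f, facetWeight M K τ f * q.normalComp τ f * q.normalComp τ f = 0 := by linarith
  have e2 : ∑ i, ∑ τ : LocalCell M K i, localVolume M K i τ * q.2.1 i τ * q.2.1 i τ = 0 := by
    linarith
  have e3 : ∑ i, ∑ j, (K.kN s(i, j))⁻¹ * q.2.2.1 i j * q.2.2.1 i j = 0 := by linarith
  refine Prod.ext (Subtype.ext (funext fun τ => ?_)) (Prod.ext (funext fun i => funext fun τ => ?_)
    (Subtype.ext (funext fun i => funext fun j => ?_)))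
  · refine Cell.eq_zero_of_normal_eq_zero (q.1.2.1.1 τ) fun f => ?_
    have := (Finset.sum_eq_zero_iff_of_nonneg fun f _ => hw τ f).1
      ((Finset.sum_eq_zero_iff_of_nonneg fun τ _ => Finset.sum_nonneg fun f _ => hw τ f).1 e1 τ
        (Finset.mem_univ _)) f (Finset.mem_univ _)
    rw [mul_assoc, mul_eq_zero_iff_left (facetWeight_pos M K τ f).ne', mul_self_eq_zero] at this
    exact this
  · have := (Finset.sum_eq_zero_iff_of_nonneg fun τ _ => hl i τ).1
      ((Finset.sum_eq_zero_iff_of_nonneg fun i _ => Finset.sum_nonneg fun τ _ => hl i τ).1 e2 i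
        (Finset.mem_univ _)) τ (Finset.mem_univ _)
    rw [mul_assoc, mul_eq_zero_iff_left (localVolume_pos i τ).ne', mul_self_eq_zero] at this
    exact this
  · have := (Finset.sum_eq_zero_iff_of_nonneg fun j _ => hk i j).1
      ((Finset.sum_eq_zero_iff_of_nonneg fun i _ => Finset.sum_nonneg fun j _ => hk i j).1 e3 i
        (Finset.mem_univ _)) j (Finset.mem_univ _)
    by_cases h : F.graph.Adj i j
    · rw [mul_assoc, mul_eq_zero_iff_left (inv_pos.2 (K.kN_pos _ h)).ne', mul_self_eq_zero] at this
      exact this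
    · exact q.2.2.2.2 i j h

lemma lumpedForm_pos (q : Flux M K) (hq : q ≠ 0) : 0 < lumpedForm M K q q :=
  lt_of_le_of_ne (lumpedInner_self_nonneg_and q).1
    fun h => hq ((lumpedInner_self_nonneg_and q).2 h.symm)

/-- The normal components on all facets embed the space into a finite-dimensional one. -/
instance : FiniteDimensional ℝ M.RTzero := by
  let φ : M.RTzero →ₗ[ℝ] ((τ : ι) → (M.cell τ).Facet → ℝ) :=
    { toFun := fun q τ f =>
        inner ℝ (q.1 τ ((M.cell τ).facetCenter f)) ((M.cell τ).normal f)
      map_add' := fun q v => by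
        funext τ f
        exact inner_add_left _ _ _
      map_smul' := fun r q => by
        funext τ f
        exact real_inner_smul_left _ _ _ }
  refine FiniteDimensional.of_injective φ ((injective_iff_map_eq_zero φ).2 fun q hq => ?_)
  refine Subtype.ext (funext fun τ => ?_)
  exact Cell.eq_zero_of_normal_eq_zero (q.2.1.1 τ) fun f => congrFun (congrFun hq τ) f

/-- The form `(𝔭, 𝔇 ⬝ 𝔳)` as a bilinear form. -/
def divForm (M : Mesh ι Ω) (K : Parameters Ω F) : Pressure ι F →ₗ[ℝ] Flux M K →ₗ[ℝ] ℝ :=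
  LinearMap.mk₂ ℝ (fun p v => l2Inner Ω (M.toMDFun p) v.mdDiv)
    (fun p p' v => by
      simp only [l2Inner_mdDiv_eq, Prod.fst_add, Prod.snd_add, Pi.add_apply, add_mul,
        Finset.sum_add_distrib]
      ring)
    (fun r p v => by
      simp only [l2Inner_mdDiv_eq, Prod.smul_fst, Prod.smul_snd, Pi.smul_apply, smul_eq_mul,
        mul_assoc, ← Finset.mul_sum, ← mul_sub, ← mul_add])
    (fun p v v' => by
      have : ∀ i : F.Free, (if h : F.IsTerminal i.1 then
          ∑ τ : LocalCell M K ⟨i.1, h⟩, transferWeight M K ⟨i.1, h⟩ τ *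
            (v + v').2.1 ⟨i.1, h⟩ τ else 0) =
          (if h : F.IsTerminal i.1 then ∑ τ : LocalCell M K ⟨i.1, h⟩,
            transferWeight M K ⟨i.1, h⟩ τ * v.2.1 ⟨i.1, h⟩ τ else 0) +
          (if h : F.IsTerminal i.1 then ∑ τ : LocalCell M K ⟨i.1, h⟩,
            transferWeight M K ⟨i.1, h⟩ τ * v'.2.1 ⟨i.1, h⟩ τ else 0) := by
        intro i
        split_ifs
        · simp only [Flux.transfer_coeff_add, mul_add, Finset.sum_add_distrib]
        · rw [add_zero]
      simp only [l2Inner_mdDiv_eq, this]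
      simp only [Flux.divergence_add, Flux.transfer_coeff_add,
        Flux.edge_add, mul_add, mul_sub, Finset.sum_add_distrib, Finset.sum_sub_distrib]
      ring)
    (fun r p v => by
      have : ∀ i : F.Free, (if h : F.IsTerminal i.1 then
          ∑ τ : LocalCell M K ⟨i.1, h⟩, transferWeight M K ⟨i.1, h⟩ τ *
            (r • v).2.1 ⟨i.1, h⟩ τ else 0) =
          r * (if h : F.IsTerminal i.1 then ∑ τ : LocalCell M K ⟨i.1, h⟩,
            transferWeight M K ⟨i.1, h⟩ τ * v.2.1 ⟨i.1, h⟩ τ else 0) := by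
        intro i
        split_ifs
        · simp only [Flux.transfer_coeff_smul, mul_left_comm _ r, Finset.mul_sum]
        · rw [mul_zero]
      simp only [l2Inner_mdDiv_eq, this]
      simp only [Flux.divergence_smul, Flux.transfer_coeff_smul,
        Flux.edge_smul, smul_eq_mul, mul_left_comm _ r, ← Finset.mul_sum, ← mul_sub, ← mul_add])

/-! ### The discrete gradient. -/

/-- The discrete gradient as a linear map. -/
def gradMap (M : Mesh ι Ω) (K : Parameters Ω F) : Pressure ι F →ₗ[ℝ] Flux M K :=
  -((LinearEquiv.ofBijective (lumpedForm M K)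
    (bijective_of_pos _ lumpedForm_pos)).symm.toLinearMap ∘ₗ divForm M K)

lemma lumpedForm_gradMap (p : Pressure ι F) : lumpedForm M K (gradMap M K p) = -divForm M K p := by
  rw [gradMap, LinearMap.neg_apply, map_neg]
  congr 1
  exact (LinearEquiv.ofBijective (lumpedForm M K)
    (bijective_of_pos _ lumpedForm_pos)).apply_symm_apply _

/-- Injectivity of `lumpedForm` gives uniqueness and its surjectivity, built into `gradMap`, gives
existence. -/
lemma isDiscreteGradient_iff (p : Pressure ι F) (g : Flux M K) :
    IsDiscreteGradient p g ↔ g = gradMap M K p := by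
  rw [← (bijective_of_pos (lumpedForm M K) lumpedForm_pos).1.eq_iff, lumpedForm_gradMap]
  exact ⟨fun h => LinearMap.ext h, fun h v => LinearMap.congr_fun h v⟩

lemma discreteGradient_eq (p : Pressure ι F) : discreteGradient M K p = gradMap M K p :=
  (isDiscreteGradient_iff p _).1
    (Classical.epsilon_spec (p := fun g => IsDiscreteGradient p g)
      ⟨gradMap M K p, (isDiscreteGradient_iff p _).2 rfl⟩)

lemma lumpedInner_gradMap (p : Pressure ι F) (v : Flux M K) :
    lumpedInner (gradMap M K p) v = -l2Inner Ω (M.toMDFun p) v.mdDiv :=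
  (isDiscreteGradient_iff p _).2 rfl v

/-! ### Injectivity of the discrete gradient -/

section Kernel

variable {p : Pressure ι F}

/-- Test with the basis function of the shared facet: the pairing is `|f| (p_τ - p_σ)`. -/
lemma pressure_eq_of_shared
    (hp : ∀ v : Flux M K, l2Inner Ω (M.toMDFun p) v.mdDiv = 0)
    {τ σ : ι} {f : (M.cell τ).Facet} {g : (M.cell σ).Facet} (h : τ ≠ σ)
    (hfg : (M.cell τ).facet f = (M.cell σ).facet g) : p.1 τ = p.1 σ := by
  obtain ⟨v, hv, hτ, hσ, h0⟩ := Mesh.exists_mem_RTzero_of_shared h hfg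
  have h1 := hp (⟨v, hv⟩, 0, 0)
  rw [l2Inner_mdDiv_eq] at h1
  simp only [Pi.zero_apply, mul_zero, Finset.sum_const_zero, sub_zero,
    Submodule.coe_zero, dite_eq_ite, ite_self, add_zero] at h1
  rw [Finset.sum_eq_add τ σ h] at h1
  · have hneg : divergence (v σ) 0 = -divergence ((M.cell σ).shape g) 0 := by
      have := Cell.divergence_smul ((M.cell σ).shape_mem_RT0 g) (-1) 0
      rw [neg_one_smul, neg_one_mul] at this
      rw [hσ, this]
    rw [hneg, hτ, mul_neg, Cell.volume_mul_divergence_shape, Cell.volume_mul_divergence_shape,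
      ← hfg, mul_neg, ← sub_eq_add_neg, ← sub_mul] at h1
    exact sub_eq_zero.1 ((mul_eq_zero.1 h1).resolve_right ((M.cell τ).facet_measure_pos f).ne')
  · intro ρ _ hρ
    have : divergence (0 : Euc n → Euc n) 0 = 0 := by
      have := Cell.divergence_smul (zero_mem (M.cell ρ).RT0) 0 0
      rwa [zero_smul, zero_mul] at this
    rw [h0 ρ hρ.1 hρ.2, this, mul_zero, mul_zero]
  · simp
  · simp

/-- Test with the transfer flux that is `1` on one cell of nonzero weight: the pairing is the weight
times the difference of the two pressures. -/
lemma pressure_terminal_eq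
    (hp : ∀ v : Flux M K, l2Inner Ω (M.toMDFun p) v.mdDiv = 0) (i : F.Terminal) :
    ∃ τ, p.2 ⟨i.1, fun h => i.2.1 (Or.inl h)⟩ = p.1 τ := by
  obtain ⟨τ, hτ⟩ := exists_transferWeight_ne_zero M K i
  refine ⟨τ, ?_⟩
  have hdiv : divergence (0 : Euc n → Euc n) 0 = 0 := by
    have := Cell.divergence_smul (zero_mem (M.cell τ).RT0) 0 0
    rwa [zero_smul, zero_mul] at this
  have h1 := hp (0, Pi.single i (Pi.single τ 1), 0)
  rw [l2Inner_mdDiv_eq] at h1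
  simp only [Submodule.coe_zero, Pi.zero_apply, hdiv, mul_zero, Finset.sum_const_zero, zero_sub,
    sub_zero] at h1
  rw [Finset.sum_eq_single i, Finset.sum_eq_single τ,
    Finset.sum_eq_single (⟨i.1, fun h => i.2.1 (Or.inl h)⟩ : F.Free)] at h1
  · rw [dif_pos i.2, Finset.sum_eq_single τ] at h1
    · simp only [Pi.single_eq_same, mul_one] at h1
      have : (p.2 ⟨i.1, fun h => i.2.1 (Or.inl h)⟩ - p.1 τ) * transferWeight M K i τ = 0 := by
        rw [sub_mul]
        linarith
      exact sub_eq_zero.1 ((mul_eq_zero.1 this).resolve_right hτ)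
    · intro σ _ hσ
      simp [hσ]
    · simp
  · intro j _ hj
    split_ifs with h
    · have hne : (⟨j.1, h⟩ : F.Terminal) ≠ i := fun e => hj (Subtype.ext (Subtype.ext_iff.1 e :))
      simp [Pi.single_eq_of_ne hne]
    · simp
  · simp
  · intro σ _ hσ
    simp [hσ]
  · simp
  · intro j _ hj
    simp [Pi.single_eq_of_ne hj]
  · simp

/-- Test with a unit flow from `i` to `j`. Dirichlet nodes carry no unknown and do not occur in the
pairing, which amounts to the value `0` there. -/
lemma pressure_eq_of_adj
    (hp : ∀ v : Flux M K, l2Inner Ω (M.toMDFun p) v.mdDiv = 0)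
    {i j : V} (hij : F.graph.Adj i j) :
    (if h : i ∉ F.dirichlet then p.2 ⟨i, h⟩ else 0) =
      if h : j ∉ F.dirichlet then p.2 ⟨j, h⟩ else 0 := by
  let e : V → V → ℝ := fun a b =>
    (if a = i ∧ b = j then 1 else 0) - if a = j ∧ b = i then 1 else 0
  have he : e ∈ F.EdgeFlux := by
    refine ⟨fun a b => ?_, fun a b hab => ?_⟩
    · simp only [e, and_comm]
      ring
    · have h1 : ¬ (a = i ∧ b = j) := fun h => hab (h.1 ▸ h.2 ▸ hij)
      have h2 : ¬ (a = j ∧ b = i) := fun h => hab (h.1 ▸ h.2 ▸ hij.symm)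
      simp only [e, if_neg h1, if_neg h2, sub_zero]
  have hdiv : divergence (0 : Euc n → Euc n) 0 = 0 := by
    -- Any cell will do: it only provides a Raviart-Thomas space containing the zero field.
    have hc : Cell n := .box 0 (EuclideanSpace.basisFun (Fin n) ℝ).toBasis
    have := Cell.divergence_smul (zero_mem hc.RT0) 0 0
    rwa [zero_smul, zero_mul] at this
  have h1 := hp (0, 0, ⟨e, he⟩)
  rw [l2Inner_mdDiv_eq] at h1
  simp only [Submodule.coe_zero, Pi.zero_apply, hdiv, mul_zero, Finset.sum_const_zero, zero_sub,
    dite_eq_ite, ite_self, zero_add, sub_zero] at h1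
  have hsum : ∀ k : V, ∑ l, e l k = (if k = j then 1 else 0) - if k = i then 1 else 0 := by
    intro k
    simp [e, Finset.sum_sub_distrib, ite_and]
  have hval : ∀ m : V, ∑ k : F.Free, p.2 k * (if k.1 = m then 1 else 0) =
      if h : m ∉ F.dirichlet then p.2 ⟨m, h⟩ else 0 := by
    intro m
    by_cases h : m ∉ F.dirichlet
    · rw [dif_pos h, Finset.sum_eq_single (⟨m, h⟩ : F.Free)]
      · simp
      · intro k _ hk
        rw [if_neg fun e => hk (Subtype.ext e), mul_zero]
      · simp
    · rw [dif_neg h]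
      refine Finset.sum_eq_zero fun k _ => ?_
      rw [if_neg fun e : k.1 = m => h (e ▸ k.2), mul_zero]
  simp only [hsum, mul_neg, mul_sub, Finset.sum_neg_distrib, Finset.sum_sub_distrib, hval] at h1
  linarith

lemma pressure_eq_of_reachable
    (hp : ∀ v : Flux M K, l2Inner Ω (M.toMDFun p) v.mdDiv = 0)
    {i j : V} (hij : F.graph.Reachable i j) :
    (if h : i ∉ F.dirichlet then p.2 ⟨i, h⟩ else 0) =
      if h : j ∉ F.dirichlet then p.2 ⟨j, h⟩ else 0 := by
  obtain ⟨w⟩ := hij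
  induction w with
  | nil => rfl
  | cons h _ ih => exact (pressure_eq_of_adj hp h).trans ih

/-- A discrete pressure that is orthogonal to all divergences vanishes. -/
lemma pressure_eq_zero
    (hp : ∀ v : Flux M K, l2Inner Ω (M.toMDFun p) v.mdDiv = 0)
    (hΩ : IsConnected Ω) (hF : F.dirichlet.Nonempty) : p = 0 := by
  have hconst := M.eq_of_eq_on_shared hΩ (p := p.1)
    fun τ σ f g h hfg => pressure_eq_of_shared hp h hfg
  -- Values are constant along each tree, and a terminal node of the tree takes the pressure of some
  -- cell.
  have hterm : ∀ v, ∃ τ, (if h : v ∉ F.dirichlet then p.2 ⟨v, h⟩ else 0) = p.1 τ := by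
    intro v
    obtain ⟨t, ht, hvt⟩ := F.exists_isTerminal_reachable v
    obtain ⟨τ, hτ⟩ := pressure_terminal_eq hp ⟨t, ht⟩
    refine ⟨τ, ?_⟩
    rw [pressure_eq_of_reachable hp hvt, dif_pos fun h => ht.1 (Or.inl h)]
    exact hτ
  obtain ⟨d, hd⟩ := hF
  -- At a Dirichlet node the value is zero, hence so is the constant cell pressure, and then the
  -- values on all other trees.
  obtain ⟨τ₀, h0⟩ := hterm d
  rw [dif_neg (not_not.2 hd)] at h0
  have hD : ∀ τ, p.1 τ = 0 := fun τ => (hconst τ τ₀).trans h0.symm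
  refine Prod.ext (funext hD) (funext fun i => ?_)
  obtain ⟨τ, hτ⟩ := hterm i.1
  rw [dif_pos i.2, hD] at hτ
  exact hτ

end Kernel

end Forms

/-! ### Stability and well-posedness -/

section WellPosed

variable {n : ℕ} {ι V : Type*} [Fintype ι] [Fintype V] {Ω : Set (Euc n)}
  {F : RootedForest V}

lemma l2Inner_self_nonneg (u : MDFun n F) : 0 ≤ l2Inner Ω u u :=
  add_nonneg (integral_nonneg fun _ => mul_self_nonneg _)
    (Finset.sum_nonneg fun _ _ => mul_self_nonneg _)

lemma l2Inner_comm (u w : MDFun n F) : l2Inner Ω u w = l2Inner Ω w u := by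
  simp only [l2Inner, mul_comm]

/-- The Cauchy-Schwarz inequality in `L²(𝔅)`. -/
lemma l2Inner_le_mul (u w : MDFun n F) (hu : MemLp u.1 2 (volume.restrict Ω))
    (hw : MemLp w.1 2 (volume.restrict Ω)) : l2Inner Ω u w ≤ l2Norm Ω u * l2Norm Ω w := by
  -- The squared norm of `u + t w` is a nonnegative quadratic in `t`, so its discriminant is
  -- nonpositive.
  have hquad : ∀ t : ℝ, 0 ≤ l2Inner Ω w w * (t * t) + 2 * l2Inner Ω u w * t + l2Inner Ω u u := by
    intro t
    have h := l2Inner_self_nonneg (Ω := Ω) (u + t • w)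
    have huu : Integrable (fun x => u.1 x * u.1 x) (volume.restrict Ω) := hu.integrable_mul hu
    have huw : Integrable (fun x => u.1 x * w.1 x) (volume.restrict Ω) := hu.integrable_mul hw
    have hww : Integrable (fun x => w.1 x * w.1 x) (volume.restrict Ω) := hw.integrable_mul hw
    have h1 : ∫ x in Ω, (u + t • w).1 x * (u + t • w).1 x =
        (∫ x in Ω, u.1 x * u.1 x) + 2 * t * (∫ x in Ω, u.1 x * w.1 x) +
          t * t * ∫ x in Ω, w.1 x * w.1 x := by
      rw [← integral_const_mul, ← integral_const_mul, ← integral_add huu (huw.const_mul _),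
        ← integral_add (f := fun x => u.1 x * u.1 x + 2 * t * (u.1 x * w.1 x))
          (huu.add (huw.const_mul _)) (hww.const_mul _)]
      refine integral_congr_ae (Filter.Eventually.of_forall fun x => ?_)
      simp only [Prod.fst_add, Prod.smul_fst, Pi.add_apply, Pi.smul_apply, smul_eq_mul]
      ring
    have h2 : ∑ i, (u + t • w).2 i * (u + t • w).2 i =
        ∑ i, u.2 i * u.2 i + 2 * t * ∑ i, u.2 i * w.2 i + t * t * ∑ i, w.2 i * w.2 i := by
      rw [Finset.mul_sum, Finset.mul_sum, ← Finset.sum_add_distrib, ← Finset.sum_add_distrib]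
      refine Finset.sum_congr rfl fun i _ => ?_
      simp only [Prod.snd_add, Prod.smul_snd, Pi.add_apply, Pi.smul_apply, smul_eq_mul]
      ring
    rw [l2Inner, h1, h2] at h
    simp only [l2Inner]
    linarith
  have hd := discrim_le_zero hquad
  rw [discrim] at hd
  rw [l2Norm, l2Norm, ← Real.sqrt_mul (l2Inner_self_nonneg u)]
  refine Real.le_sqrt_of_sq_le ?_
  linarith

lemma l2Norm_nonneg (u : MDFun n F) : 0 ≤ l2Norm Ω u := Real.sqrt_nonneg _

lemma sq_l2Norm (u : MDFun n F) : l2Norm Ω u ^ 2 = l2Inner Ω u u :=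
  Real.sq_sqrt (l2Inner_self_nonneg u)

variable [NeZero n] (M : Mesh ι Ω) (K : Parameters Ω F)

/-- The pairing of a right-hand side with discrete pressures. -/
def loadForm (r : MDFun n F) (hr : MemLp r.1 2 (volume.restrict Ω)) : Pressure ι F →ₗ[ℝ] ℝ where
  toFun w := l2Inner Ω r (M.toMDFun w)
  map_add' w w' := by
    simp only [l2Inner_toMDFun_eq r hr, Prod.fst_add, Prod.snd_add, Pi.add_apply, add_mul,
      Finset.sum_add_distrib]
    ring
  map_smul' t w := by
    simp only [l2Inner_toMDFun_eq r hr, Prod.smul_fst, Prod.smul_snd, Pi.smul_apply, smul_eq_mul,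
      mul_assoc, ← Finset.mul_sum, ← mul_add, RingHom.id_apply]

lemma loadForm_apply (r : MDFun n F) (hr : MemLp r.1 2 (volume.restrict Ω)) (w : Pressure ι F) :
    loadForm M r hr w = l2Inner Ω r (M.toMDFun w) := rfl

/-- The `L²` inner product of discrete pressures. -/
def massForm (F : RootedForest V) : Pressure ι F →ₗ[ℝ] Pressure ι F →ₗ[ℝ] ℝ :=
  LinearMap.mk₂ ℝ (fun p w => l2Inner Ω (M.toMDFun p) (M.toMDFun w))
    (fun p p' w => by
      simp only [l2Inner_comm _ (M.toMDFun w)]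
      exact (loadForm M _ (M.memLp_pwConst w.1)).map_add p p')
    (fun r p w => by
      simp only [l2Inner_comm _ (M.toMDFun w)]
      exact (loadForm M _ (M.memLp_pwConst w.1)).map_smul r p)
    (fun p w w' => (loadForm M _ (M.memLp_pwConst p.1)).map_add w w')
    (fun r p w => (loadForm M _ (M.memLp_pwConst p.1)).map_smul r w)

/-- The bilinear form of the two-point flux approximation scheme. -/
def tpfaForm : Pressure ι F →ₗ[ℝ] Pressure ι F →ₗ[ℝ] ℝ :=
  (lumpedForm M K).compl₁₂ (gradMap M K) (gradMap M K)

lemma tpfaForm_apply (p w : Pressure ι F) :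
    tpfaForm M K p w = lumpedInner (discreteGradient M K p) (discreteGradient M K w) := by
  rw [discreteGradient_eq, discreteGradient_eq]
  rfl

/-- A pressure with zero energy has zero discrete gradient, hence is orthogonal to all divergences.
-/
lemma tpfaForm_pos (hΩ : IsConnected Ω) (hF : F.dirichlet.Nonempty) (p : Pressure ι F)
    (hp : p ≠ 0) : 0 < tpfaForm M K p p := by
  refine lumpedForm_pos _ fun h => hp (pressure_eq_zero (M := M) (K := K) (fun v => ?_) hΩ hF)
  have h1 := LinearMap.congr_fun (lumpedForm_gradMap (M := M) (K := K) p) v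
  rw [h, map_zero, LinearMap.zero_apply, LinearMap.neg_apply, zero_eq_neg] at h1
  exact h1

lemma isTPFASolution_iff (r : MDFun n F) (hr : MemLp r.1 2 (volume.restrict Ω))
    (p : Pressure ι F) : IsTPFASolution M K r p ↔ tpfaForm M K p = loadForm M r hr := by
  refine ⟨fun h => LinearMap.ext fun w => ?_, fun h w => ?_⟩
  · rw [tpfaForm_apply, h w, loadForm_apply]
  · rw [← tpfaForm_apply, h, loadForm_apply]

/-- The first equation says that `-q` is the discrete gradient of `p`. Taking `q` as test flux for
the gradient of `w` then turns `(𝔇 ⬝ q, w)` into `(𝔇_h p, 𝔇_h w)`, so the second equation becomes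
the scheme. -/
lemma isMassLumpedSolution_iff (r : MDFun n F) (q : Flux M K) (p : Pressure ι F) :
    IsMassLumpedSolution r q p ↔ q = -discreteGradient M K p ∧ IsTPFASolution M K r p := by
  have h1 : (∀ v : Flux M K, lumpedInner q v - l2Inner Ω (M.toMDFun p) v.mdDiv = 0) ↔
      q = -discreteGradient M K p := by
    rw [discreteGradient_eq, ← neg_eq_iff_eq_neg, ← isDiscreteGradient_iff]
    refine forall_congr' fun v => ?_
    have : lumpedInner (-q) v = -lumpedInner q v := by
      rw [← lumpedForm_apply, map_neg, LinearMap.neg_apply, lumpedForm_apply]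
    rw [this, neg_inj, sub_eq_zero]
  refine and_congr h1 Iff.rfl |>.trans (and_congr_right fun hq => forall_congr' fun w => ?_)
  have h2 : l2Inner Ω q.mdDiv (M.toMDFun w) =
      lumpedInner (discreteGradient M K p) (discreteGradient M K w) := by
    have h3 := lumpedInner_gradMap (M := M) (K := K) w q
    rw [l2Inner_comm, ← neg_eq_iff_eq_neg.2 h3, hq, discreteGradient_eq, discreteGradient_eq,
      ← lumpedForm_apply, map_neg, neg_neg, lumpedForm_apply, lumpedInner_comm]
  rw [neg_inj, h2]

/-- Existence, uniqueness and stability of solutions of the scheme. -/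
lemma tpfa_wellPosed (hΩ : IsConnected Ω) (hF : F.dirichlet.Nonempty) :
    ∃ C : ℝ, 0 < C ∧ ∀ r : MDFun n F, MemLp r.1 2 (volume.restrict Ω) →
      ∃ p : Pressure ι F, IsTPFASolution M K r p ∧
        (∀ p', IsTPFASolution M K r p' → p' = p) ∧
        l2Norm Ω (M.toMDFun p) +
          √(lumpedInner (discreteGradient M K p) (discreteGradient M K p)) ≤ C * l2Norm Ω r := by
  have hpos := tpfaForm_pos M K hΩ hF
  obtain ⟨c, hc, hle⟩ := exists_forall_le_mul (tpfaForm M K) (massForm M F) hpos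
  have hbij := bijective_of_pos (tpfaForm M K) hpos
  -- With `N`, `R` the norms of solution and data and `a` the energy, `N² ≤ c a` and `a ≤ R N` give
  -- `N ≤ c R`, and then `√a ≤ √c R`.
  refine ⟨c + √c, by positivity, fun r hr => ?_⟩
  obtain ⟨p, hp⟩ := hbij.2 (loadForm M r hr)
  refine ⟨p, (isTPFASolution_iff M K r hr p).2 hp, fun p' hp' => hbij.1 ?_, ?_⟩
  · rw [(isTPFASolution_iff M K r hr p').1 hp', hp]
  set N := l2Norm Ω (M.toMDFun p)
  set R := l2Norm Ω r
  have hN : 0 ≤ N := l2Norm_nonneg _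
  have hR : 0 ≤ R := l2Norm_nonneg _
  have hA : tpfaForm M K p p ≤ R * N := by
    rw [hp, loadForm_apply]
    exact l2Inner_le_mul r _ hr (M.memLp_pwConst p.1)
  have hNN : N ^ 2 ≤ c * tpfaForm M K p p := by
    rw [sq_l2Norm]
    exact hle p
  have hNR : N ≤ c * R := by
    rcases hN.eq_or_lt with h0 | h0
    · rw [← h0]
      positivity
    · refine le_of_mul_le_mul_right ?_ h0
      calc N * N = N ^ 2 := (sq N).symm
        _ ≤ c * (R * N) := hNN.trans (mul_le_mul_of_nonneg_left hA hc.le)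
        _ = c * R * N := by ring
  have hAR : √(tpfaForm M K p p) ≤ √c * R := by
    refine (Real.sqrt_le_left (by positivity)).2 ?_
    rw [mul_pow, Real.sq_sqrt hc.le]
    calc tpfaForm M K p p ≤ R * N := hA
      _ ≤ R * (c * R) := mul_le_mul_of_nonneg_left hNR hR
      _ = c * R ^ 2 := by ring
  rw [← tpfaForm_apply, add_mul]
  exact add_le_add hNR hAR

end WellPosed

end NetworkDarcy

end

open NetworkDarcy
theorem theorem4p6 {n : ℕ} [NeZero n] {ι V : Type*} [Fintype ι] [Fintype V]
    {Ω : Set (Euc n)} (hΩ : IsConnected Ω) (M : Mesh ι Ω)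
    (F : RootedForest V) (hF : F.dirichlet.Nonempty) (K : Parameters Ω F) :
    (∀ p : Pressure ι F, ∃! g : Flux M K, IsDiscreteGradient p g) ∧
    (∃ C : ℝ, 0 < C ∧ ∀ r : MDFun n F, MemLp r.1 2 (volume.restrict Ω) →
      ∃ p : Pressure ι F, IsTPFASolution M K r p ∧
        (∀ p', IsTPFASolution M K r p' → p' = p) ∧
        l2Norm Ω (M.toMDFun p) +
          √(lumpedInner (discreteGradient M K p) (discreteGradient M K p)) ≤ C * l2Norm Ω r) ∧
    (∀ r : MDFun n F, MemLp r.1 2 (volume.restrict Ω) →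
      ∀ (q : Flux M K) (p : Pressure ι F),
        IsMassLumpedSolution r q p ↔
          q = -discreteGradient M K p ∧ IsTPFASolution M K r p) :=
  ⟨fun p => ⟨gradMap M K p, (isDiscreteGradient_iff p _).2 rfl,
      fun _ hg => (isDiscreteGradient_iff p _).1 hg⟩,
    tpfa_wellPosed M K hΩ hF, fun r _ q p => isMassLumpedSolution_iff M K r q p⟩
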